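/- **Setting.** Fix reals $M>0$, $B$, and integers $K,m\ge 0$. Let $s\in(1/2,1)$ with $m\ge \frac{2}{1-s}+4$, and $\varepsilon\in(0,1)$. *Mother wave packet.* $w\in C^m(\mathbb R;\mathbb C)\cap L^1$ is of type $(\varepsilon,m)$: its Fourier transform $\widehat w(\xi)=\int w(x)e^{-2\pi i x\xi}dx$ is real-valued and $C^\infty$, $\widehat w(\xi)\neq 0$ for $|\xi|<1$, and $|\widehat w(\xi)|\le \varepsilon(1+|\xi|)^{-m}$ for $|\xi|>1$. Moreover $w$ has size at most $B$: $\int(1+x^2)|w|\,dx\le B$, $\int|w'|\,dx\le B$ and $\|w\|^2\ge 1/B$, where $\|\cdot\|$ is the $L^2$ norm (every nonzero $C^1$ function that is compactly supported or a Schwartz function has this for some $B$). Put $w_{ab}(x)=|a|^{s/2}w(|a|^s(x-b))e^{2\pi i(x-b)a}$ and $W_f(a,b)=\int f\,\overline{w_{ab}}\,dx$. *Signal.* $f=\sum_{k=1}^K\alpha_k e^{2\pi i N_k\phi_k}$ with $N_k\ge N$, real $C^\infty$ functions $\alpha_k,\phi_k$ satisfying $|\alpha_k'|\le M$, $1/M\le\alpha_k\le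 M$, $1/M\le|\phi_k'|\le M$, $|\phi_k''|\le M$, and for every $(a,b)\in\mathbb R^2$ at most one $k$ satisfies $|a-N_k\phi_k'(b)|\le|a|^s$. *Noise.* Let $\varepsilon_1\in(0,1]$, $q>0$, $p\in(0,\tfrac12]$, and let $e$ be real zero-mean Gaussian white noise on $\mathbb R$ of variance $\varepsilon_1^{1+q}$, i.e. a centered Gaussian family $e(h)$, $h\in L^2(\mathbb R;\mathbb R)$, with $\mathbb E[e(h)e(k)]=\varepsilon_1^{1+q}\langle h,k\rangle$. For $u\in L^2(\mathbb R;\mathbb C)$ put $\langle e,u\rangle=e(\operatorname{Re}u)-i\,e(\operatorname{Im}u)$. For $g=f+e$ let $W_g=W_f+\langle e,w_{ab}\rangle$, $\partial_bW_g=\partial_bW_f+\langle e,\partial_bw_{ab}\rangle$ and $v_g=\frac{\partial_bW_g}{2\pi i\,W_g}$. With $\delta=\sqrt\varepsilon+\varepsilon_1^{1/2-p}$ and $a\ne0$, put $$R_\delta=\{|W_g(a,b)|\ge|a|^{-s/2}\delta\},\quad S_\delta=\{|W_g(a,b)|\ge\delta\},\quad Z_k=\{|a-N_k\phi_k'(b)|\le|a|^s\}.$$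 **Theorem.** There are constants $c,C>0$ depending only on $M,K,m,B$, and $C_0>0$ depending only on $M,K,m,B,s$, such that for all $\varepsilon$, $w$, $\varepsilon_1$, $q$, $p$, $e$ as above, every $N>N_0:=C_0\max\{\varepsilon^{-1/(2s-1)},\varepsilon^{-1/(1-s)}\}$ and every $f$ as above: 1. $Z_1,\dots,Z_K$ are pairwise disjoint. 2. Suppose $2MK\sqrt\varepsilon\le 2^m$. For every $(a,b)$ with $a\neq0$, the event "$(a,b)\in R_\delta$ implies $(a,b)\in\bigcup_kZ_k$" has probability at least $$1-e^{-c|a|^{-s}\varepsilon_1^{-q}}-C\varepsilon|a|^{-m(1-s)};$$ and for every $k$ with $\frac{N_k}{2M}\le|a|\le 2MN_k$ it has probability at least $1-e^{-cN_k^{-s}\varepsilon_1^{-q}}-C\varepsilon N_k^{-m(1-s)}$. 3. Suppose $2MK\sqrt\varepsilon\le 2^m$. For every $(a,b)$ with $|a|\ge1$, the event "$(a,b)\in S_\delta$ implies $(a,b)\in\bigcup_kZ_k$" has probability at least $$1-e^{-\varepsilon_1^{-q}\|w\|^{-2}}-C\varepsilon|a|^{-m(1-s)};$$ and for every $k$ with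 $\frac{N_k}{2M}\le|a|\le 2MN_k$ it has probability at least $1-e^{-\varepsilon_1^{-q}\|w\|^{-2}}-C\varepsilon N_k^{-m(1-s)}$. 4. For every $k$ and $(a,b)\in Z_k$, the event "$(a,b)\in R_\delta$ implies $\frac{|v_g(a,b)-N_k\phi_k'(b)|}{|N_k\phi_k'(b)|}\le C(\sqrt\varepsilon+\varepsilon_1^p)$" has probability at least $$\left(1-e^{-cN_k^{2-3s}\varepsilon_1^{-q}}\right)\left(1-e^{-cN_k^{-s-2}\varepsilon_1^{-q}}\right)-C\varepsilon N_k^{-((m-4)(1-s)-2)}.$$ 5. For every $k$ and $(a,b)\in Z_k$, the event "$(a,b)\in S_\delta$ implies $\frac{|v_g(a,b)-N_k\phi_k'(b)|}{|N_k\phi_k'(b)|}\le C\,\frac{\sqrt\varepsilon+\varepsilon_1^p}{N_k^{s/2}}$" has probability at least $$\left(1-e^{-cN_k^{2-2s}\varepsilon_1^{-q}}\right)\left(1-e^{-cN_k^{-2}\varepsilon_1^{-q}}\right)-C\varepsilon N_k^{-((m-4)(1-s)-2)}.$$ -/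

import Mathlib

open MeasureTheory ProbabilityTheory
open scoped FourierTransform

namespace SST

noncomputable section

/-- A one-dimensional mother wave packet of type `(ε, m)`: a (Lebesgue integrable) `C^m` function
whose Fourier transform `ŵ(ξ) = ∫ w(x) e^{-2π i x ξ} dx` is real-valued and smooth, does not vanish
on `|ξ| < 1` and is bounded by `ε / (1 + |ξ|)^m` on `|ξ| > 1`. -/
structure IsMotherPacket (ε : ℝ) (m : ℕ) (w : ℝ → ℂ) : Prop where
  integrable : Integrable w
  contDiff : ContDiff ℝ m w
  fourier_real : ∀ ξ : ℝ, (𝓕 w ξ).im = 0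
  fourier_smooth : ContDiff ℝ (⊤ : ℕ∞) (𝓕 w)
  fourier_ne_zero : ∀ ξ : ℝ, |ξ| < 1 → 𝓕 w ξ ≠ 0
  fourier_decay : ∀ ξ : ℝ, 1 < |ξ| → ‖𝓕 w ξ‖ ≤ ε / (1 + |ξ|) ^ m

/-- Quantitative localization of the mother wave packet. Every `C^1` function that is compactly
supported or rapidly decreasing (together with its derivative), and is not zero, satisfies this for
some `B`; the number `B` is only used to say how constants depend on `w`. -/
structure PacketSize (B : ℝ) (w : ℝ → ℂ) : Prop where
  integrable_moment : Integrable (fun x : ℝ => (1 + x ^ 2) * ‖w x‖)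
  moment_le : ∫ x : ℝ, (1 + x ^ 2) * ‖w x‖ ≤ B
  integrable_deriv : Integrable (deriv w)
  deriv_le : ∫ x : ℝ, ‖deriv w x‖ ≤ B
  inv_le_normSq : B⁻¹ ≤ ∫ x : ℝ, ‖w x‖ ^ 2

/-- `‖w‖²`, the square of the `L²` norm. -/
def normSqL2 (w : ℝ → ℂ) : ℝ := ∫ x : ℝ, ‖w x‖ ^ 2

/-- The wave packet `w_{ab}(x) = |a|^{s/2} w(|a|^s (x - b)) e^{2π i (x - b) a}`. -/
def packet (w : ℝ → ℂ) (s a b x : ℝ) : ℂ :=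
  ((|a| ^ (s / 2) : ℝ) : ℂ) * w (|a| ^ s * (x - b)) *
    Complex.exp (2 * Real.pi * Complex.I * ((x - b) * a : ℝ))

/-- The derivative `∂_b w_{ab}` of the wave packet with respect to its center. -/
def packetDeriv (w : ℝ → ℂ) (s a b x : ℝ) : ℂ := deriv (fun b' : ℝ => packet w s a b' x) b

/-- The wave packet transform `W_f(a,b) = ∫ f(x) conj(w_{ab}(x)) dx` of a function `f`. -/
def transform (w : ℝ → ℂ) (s : ℝ) (f : ℝ → ℂ) (a b : ℝ) : ℂ :=
  ∫ x : ℝ, f x * (starRingEnd ℂ) (packet w s a b x)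

/-- Amplitude and phase of an intrinsic mode type function of type `(M, N)`
(the condition does not involve `N`). -/
structure IsModeType (M : ℝ) (α φ : ℝ → ℝ) : Prop where
  smooth_amp : ContDiff ℝ (⊤ : ℕ∞) α
  deriv_amp_le : ∀ x, |deriv α x| ≤ M
  amp_ge : ∀ x, 1 / M ≤ α x
  amp_le : ∀ x, α x ≤ M
  smooth_phase : ContDiff ℝ (⊤ : ℕ∞) φ
  deriv_phase_ge : ∀ x, 1 / M ≤ |deriv φ x|
  deriv_phase_le : ∀ x, |deriv φ x| ≤ M
  deriv2_phase_le : ∀ x, |deriv (deriv φ) x| ≤ M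

/-- The set `Z = {(a,b) : |a - ν φ'(b)| ≤ |a|^s}` attached to a frequency `ν` and a phase `φ`. -/
def Zset (s ν : ℝ) (φ : ℝ → ℝ) : Set (ℝ × ℝ) :=
  {p | |p.1 - ν * deriv φ p.2| ≤ |p.1| ^ s}

/-- The components `α_k e^{2π i N_k φ_k}` form a well-separated superposition of type
`(M, N, K, s)`. The separation condition `|a|^{-s} |a - N_k φ_k'(b)| ≤ 1` is written without
division by `|a|^s`. -/
structure IsWellSeparated (M N : ℝ) (K : ℕ) (s : ℝ) (α φ : Fin K → ℝ → ℝ) (ν : Fin K → ℝ) :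
    Prop where
  mode : ∀ k, IsModeType M (α k) (φ k)
  freq_ge : ∀ k, N ≤ ν k
  separated : ∀ (a b : ℝ) (j k : Fin K),
    |a - ν j * deriv (φ j) b| ≤ |a| ^ s → |a - ν k * deriv (φ k) b| ≤ |a| ^ s → j = k

/-- The superposition `f(x) = ∑_k α_k(x) e^{2π i N_k φ_k(x)}`. -/
def superposition {K : ℕ} (α φ : Fin K → ℝ → ℝ) (ν : Fin K → ℝ) (x : ℝ) : ℂ :=
  ∑ k, (α k x : ℂ) * Complex.exp (2 * Real.pi * Complex.I * (ν k * φ k x : ℝ))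

/-- (Real) zero mean Gaussian white noise on the line with variance `v`, as a generalized random
process: a centered Gaussian family `e(h)`, `h ∈ L²(ℝ)`, with `E[e(h) e(k)] = v ⟨h, k⟩`. -/
structure IsWhiteNoise {Ω : Type*} [MeasurableSpace Ω] (P : Measure Ω) (v : ℝ)
    (e : Lp ℝ 2 (volume : Measure ℝ) → Ω → ℝ) : Prop where
  gaussian : IsGaussianProcess e P
  mean_zero : ∀ h, ∫ ω, e h ω ∂P = 0
  covariance : ∀ h k, ∫ ω, e h ω * e k ω ∂P = v * inner ℝ h k

open Classical in
/-- The class in `L²(ℝ)` of a square integrable function (and `0` for other functions). -/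
def toL2 (h : ℝ → ℝ) : Lp ℝ 2 (volume : Measure ℝ) :=
  if hh : MemLp h 2 (volume : Measure ℝ) then hh.toLp h else 0

/-- The pairing `⟨e, u⟩ = ∫ e(x) conj(u(x)) dx` of the noise with a complex test function `u`. -/
def pairing {Ω : Type*} (e : Lp ℝ 2 (volume : Measure ℝ) → Ω → ℝ) (u : ℝ → ℂ) (ω : Ω) : ℂ :=
  (e (toL2 fun x => (u x).re) ω : ℂ) - Complex.I * (e (toL2 fun x => (u x).im) ω : ℂ)

/-- The wave packet transform `W_g = W_f + W_e` of `g = f + e`, where `W_e(a,b) = ⟨e, w_{ab}⟩`. -/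
def noisyTransform {Ω : Type*} (w : ℝ → ℂ) (s : ℝ) (f : ℝ → ℂ)
    (e : Lp ℝ 2 (volume : Measure ℝ) → Ω → ℝ) (ω : Ω) (a b : ℝ) : ℂ :=
  transform w s f a b + pairing e (packet w s a b) ω

/-- `∂_b W_g = ∂_b W_f + ∂_b W_e`, where `∂_b W_e(a,b) = ⟨e, ∂_b w_{ab}⟩`. -/
def noisyTransformDeriv {Ω : Type*} (w : ℝ → ℂ) (s : ℝ) (f : ℝ → ℂ)
    (e : Lp ℝ 2 (volume : Measure ℝ) → Ω → ℝ) (ω : Ω) (a b : ℝ) : ℂ :=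
  deriv (fun b' : ℝ => transform w s f a b') b + pairing e (packetDeriv w s a b) ω

/-- The information function `v_g = ∂_b W_g / (2π i W_g)`. -/
def noisyInfo {Ω : Type*} (w : ℝ → ℂ) (s : ℝ) (f : ℝ → ℂ)
    (e : Lp ℝ 2 (volume : Measure ℝ) → Ω → ℝ) (ω : Ω) (a b : ℝ) : ℂ :=
  noisyTransformDeriv w s f e ω a b / (2 * Real.pi * Complex.I * noisyTransform w s f e ω a b)

/-- The random set `R_δ = {(a,b) : |W_g(a,b)| ≥ |a|^{-s/2} δ}`. -/
def Rset {Ω : Type*} (w : ℝ → ℂ) (s : ℝ) (f : ℝ → ℂ)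
    (e : Lp ℝ 2 (volume : Measure ℝ) → Ω → ℝ) (δ : ℝ) (ω : Ω) : Set (ℝ × ℝ) :=
  {p | p.1 ≠ 0 ∧ |p.1| ^ (-s / 2) * δ ≤ ‖noisyTransform w s f e ω p.1 p.2‖}

/-- The random set `S_δ = {(a,b) : |W_g(a,b)| ≥ δ}`. -/
def Sset {Ω : Type*} (w : ℝ → ℂ) (s : ℝ) (f : ℝ → ℂ)
    (e : Lp ℝ 2 (volume : Measure ℝ) → Ω → ℝ) (δ : ℝ) (ω : Ω) : Set (ℝ × ℝ) :=
  {p | p.1 ≠ 0 ∧ δ ≤ ‖noisyTransform w s f e ω p.1 p.2‖}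

/-- The relative error `|v - ν φ'(b)| / |ν φ'(b)|` of `v` as an approximation of `ν φ'(b)`. -/
def relErr (v : ℂ) (ν : ℝ) (φ : ℝ → ℝ) (b : ℝ) : ℝ :=
  ‖v - ((ν * deriv φ b : ℝ) : ℂ)‖ / |ν * deriv φ b|

end

end SST

namespace SST

open Set Filter Topology

/-! At a fixed point `(a, b)` the coefficient `W_g` is a deterministic number plus one complex
Gaussian variable, so each probabilistic claim splits into a size estimate for the signal and a tail
bound for a single Gaussian variable.

Gaussian tails. The real and imaginary parts of `⟨e, u⟩` form a centered Gaussian vector whose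
covariance matrix has top eigenvalue `v (‖u‖² + |∫ u²|) / 2`. Rotating to the principal axes and
comparing with a Rayleigh variable gives `P(|⟨e, u⟩| ≥ t) ≤ exp(-t² / (v L))` whenever `‖u‖² + |∫
u²| ≤ L` (`IsWhiteNoise.pairing_tail`). For `u = w_{ab}` one always has `|∫ u²| ≤ ‖w‖²`. If `|a| ≥
1`, then `∫ u²` is moreover a self-convolution of `ŵ` at a frequency of modulus `2|a|^{1-s}`, hence
of order `ε |a|^{-m(1-s)}`. The exponent then involves `‖w‖^{-2}` exactly, at the price of an
additive error.

Outside the bands. In the variable `y = |a|^s (x - b)` a component is nearly a pure exponential. If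
`|a| ≥ ν/(2M)`, freezing the amplitude and linearizing the phase leaves a value of `ŵ` at a point of
modulus greater than 1, with error `O(ν^{1-2s})`. If `|a| < ν/(2M)`, the phase has no stationary
point and one integration by parts gives `O(ν^{s-1})`. The threshold `N₀` makes both errors small
against `ε`, so `|W_f| ≤ |a|^{-s/2} √ε` (`norm_transform_le_of_forall_notMem`). A coefficient in
`R_δ` or `S_δ` must then come from noise above the second summand of `δ`.

Inside a band. With `μ = ν φ'(b)`, the error `v_g - μ` is `(∂_b W_g - 2πi μ W_g) / (2πi W_g)`. Since
`|a - μ| ≤ |a|^s`, the carrier frequency cancels in the numerator: its signal part is `O(|a|^{s/2})`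
and its noise part is a Gaussian with standard deviation `O(√v |a|^s)`. Division by `|W_g|`, bounded
below on `R_δ` or `S_δ`, gives the relative error (`prob_inside`). One tail with exponent of order
`ν^{2-3s} ε₁^{-q}` suffices, and it beats both stated products. -/

/-! ### Rayleigh tail of the standard Gaussian of the plane -/

lemma lintegral_Ioi_mul_exp_neg_sq (t : ℝ) (ht : 0 ≤ t) :
    ∫⁻ r in Ioi t, ENNReal.ofReal (r * Real.exp (-r ^ 2 / 2)) =
      ENNReal.ofReal (Real.exp (-t ^ 2 / 2)) := by
  have hd : ∀ x ∈ Ici t, HasDerivAt (fun r : ℝ => -Real.exp (-r ^ 2 / 2))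
      (x * Real.exp (-x ^ 2 / 2)) x := by
    intro x _
    have h1 : HasDerivAt (fun r : ℝ => -r ^ 2 / 2) (-x) x := by
      convert! ((hasDerivAt_pow 2 x).neg.div_const 2) using 1
      simp; ring
    convert! h1.exp.neg using 1
    ring
  have hnn : ∀ x ∈ Ioi t, 0 ≤ x * Real.exp (-x ^ 2 / 2) := fun x hx =>
    mul_nonneg (ht.trans (le_of_lt hx)) (Real.exp_pos _).le
  have hlim : Tendsto (fun r : ℝ => -Real.exp (-r ^ 2 / 2)) atTop (𝓝 0) := by
    have h2 : Tendsto (fun r : ℝ => r ^ 2 / 2) atTop atTop :=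
      (tendsto_pow_atTop two_ne_zero).atTop_div_const two_pos
    have h3 := (Real.tendsto_exp_neg_atTop_nhds_zero.comp h2).neg
    simpa [Function.comp_def, neg_div] using h3
  rw [← ofReal_integral_eq_lintegral_ofReal
    (integrableOn_Ioi_deriv_of_nonneg' hd hnn hlim)
    ((ae_restrict_iff' measurableSet_Ioi).2 (ae_of_all _ hnn)),
    integral_Ioi_of_hasDerivAt_of_nonneg' hd hnn hlim]
  simp

/-- The standard Gaussian measure of the plane has Rayleigh tails. -/
lemma gaussianReal_prod_tail (t : ℝ) (ht : 0 ≤ t) :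
    ((gaussianReal 0 1).prod (gaussianReal 0 1)) {z : ℝ × ℝ | t ^ 2 ≤ z.1 ^ 2 + z.2 ^ 2} =
      ENNReal.ofReal (Real.exp (-t ^ 2 / 2)) := by
  have hS : MeasurableSet {z : ℝ × ℝ | t ^ 2 ≤ z.1 ^ 2 + z.2 ^ 2} :=
    measurableSet_le (by fun_prop) (by fun_prop)
  rw [gaussianReal_of_var_ne_zero _ one_ne_zero,
    prod_withDensity (measurable_gaussianPDF _ _) (measurable_gaussianPDF _ _),
    withDensity_apply _ hS, ← lintegral_indicator hS, ← Measure.volume_eq_prod,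
    ← lintegral_comp_polarCoord_symm]
  have hpi := Real.pi_pos
  -- In polar coordinates the density with its Jacobian is `r exp(-r²/2) / (2π)`, a product of a
  -- function of `r` and a constant in the angle.
  have hint : ∀ p ∈ polarCoord.target, ENNReal.ofReal p.1 •
      ({z : ℝ × ℝ | t ^ 2 ≤ z.1 ^ 2 + z.2 ^ 2}.indicator
        (fun z => gaussianPDF 0 1 z.1 * gaussianPDF 0 1 z.2) (polarCoord.symm p)) =
      (Ici t).indicator (fun r => ENNReal.ofReal (r * Real.exp (-r ^ 2 / 2))) p.1 *
        (fun _ : ℝ => ENNReal.ofReal (2 * Real.pi)⁻¹) p.2 := by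
    rintro ⟨r, θ⟩ hp
    have hr : 0 < r := hp.1
    have hsum : (r * Real.cos θ) ^ 2 + (r * Real.sin θ) ^ 2 = r ^ 2 := by
      have := Real.sin_sq_add_cos_sq θ
      linear_combination r ^ 2 * this
    by_cases h : t ≤ r
    · have hm : polarCoord.symm (r, θ) ∈ {z : ℝ × ℝ | t ^ 2 ≤ z.1 ^ 2 + z.2 ^ 2} := by
        simp only [polarCoord_symm_apply, mem_ofPred_eq, hsum]
        gcongr
      rw [indicator_of_mem hm, indicator_of_mem (show r ∈ Ici t from h)]
      simp only [polarCoord_symm_apply, gaussianPDF, gaussianPDFReal, smul_eq_mul]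
      rw [← ENNReal.ofReal_mul (by positivity), ← ENNReal.ofReal_mul (by positivity),
        ← ENNReal.ofReal_mul (by positivity)]
      congr 1
      have he : Real.exp (-(r * Real.cos θ) ^ 2 / 2) * Real.exp (-(r * Real.sin θ) ^ 2 / 2) =
          Real.exp (-r ^ 2 / 2) := by
        rw [← Real.exp_add, ← hsum]; ring_nf
      have hs : (√(2 * Real.pi))⁻¹ * (√(2 * Real.pi))⁻¹ = (2 * Real.pi)⁻¹ := by
        rw [← mul_inv, Real.mul_self_sqrt (by positivity)]
      simp only [NNReal.coe_one, mul_one, sub_zero]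
      rw [← he, ← hs]
      ring
    · have hm : polarCoord.symm (r, θ) ∉ {z : ℝ × ℝ | t ^ 2 ≤ z.1 ^ 2 + z.2 ^ 2} := by
        simp only [polarCoord_symm_apply, mem_ofPred_eq, hsum, not_le]
        have := not_le.1 h
        gcongr
      rw [indicator_of_notMem hm, indicator_of_notMem (show r ∉ Ici t from h)]
      simp
  rw [setLIntegral_congr_fun polarCoord.open_target.measurableSet hint,
    show polarCoord.target = Ioi (0 : ℝ) ×ˢ Ioo (-Real.pi) Real.pi from rfl,
    Measure.volume_eq_prod, ← Measure.prod_restrict, lintegral_prod_mul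
      (f := (Ici t).indicator (fun r => ENNReal.ofReal (r * Real.exp (-r ^ 2 / 2))))
      (g := fun _ : ℝ => ENNReal.ofReal (2 * Real.pi)⁻¹)
      (Measurable.indicator (by fun_prop) measurableSet_Ici).aemeasurable (by fun_prop),
    lintegral_const]
  rw [lintegral_indicator measurableSet_Ici, Measure.restrict_restrict measurableSet_Ici]
  -- The intersection is `Ioi t` when `t = 0` and `Ici t` when `t > 0`; these differ by a null set.
  · have hset : (Ici t ∩ Ioi (0 : ℝ) : Set ℝ) =ᵐ[volume] Ioi t := by
      rcases ht.eq_or_lt with rfl | h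
      · rw [inter_eq_self_of_subset_right Ioi_subset_Ici_self]
        exact ae_eq_refl _
      · rw [inter_eq_self_of_subset_left (Ici_subset_Ioi.2 h)]
        exact Ioi_ae_eq_Ici.symm
    rw [Measure.restrict_congr_set hset, lintegral_Ioi_mul_exp_neg_sq t ht]
    simp only [Measure.restrict_apply_univ, Real.volume_Ioo]
    rw [← ENNReal.ofReal_mul (by positivity), ← ENNReal.ofReal_mul (by positivity)]
    congr 1
    field_simp
    ring

/-! ### Second moments and almost sure linearity of white noise -/

lemma IsWhiteNoise.memLp {Ω : Type*} [MeasurableSpace Ω] {P : Measure Ω} {v : ℝ}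
    {e : Lp ℝ 2 (volume : Measure ℝ) → Ω → ℝ} (he : IsWhiteNoise P v e)
    (h : Lp ℝ 2 (volume : Measure ℝ)) : MemLp (e h) 2 P :=
  (he.gaussian.hasGaussianLaw_eval h).memLp_two

lemma IsWhiteNoise.integrable_mul {Ω : Type*} [MeasurableSpace Ω] {P : Measure Ω} {v : ℝ}
    {e : Lp ℝ 2 (volume : Measure ℝ) → Ω → ℝ} (he : IsWhiteNoise P v e)
    (h k : Lp ℝ 2 (volume : Measure ℝ)) : Integrable (fun ω => e h ω * e k ω) P :=
  (he.memLp h).integrable_mul (he.memLp k)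

/-- Linearity is not part of the definition of the noise. It follows from the covariance: by
bilinearity of the inner product the second moment of the difference is zero. The exceptional null
set depends on `h`, `k` and `r`. -/
lemma IsWhiteNoise.add_smul {Ω : Type*} [MeasurableSpace Ω] {P : Measure Ω} {v : ℝ}
    {e : Lp ℝ 2 (volume : Measure ℝ) → Ω → ℝ} (he : IsWhiteNoise P v e)
    (h k : Lp ℝ 2 (volume : Measure ℝ)) (r : ℝ) :
    e (h + r • k) =ᵐ[P] fun ω => e h ω + r * e k ω := by
  set g := h + r • k with hg
  have hmem : MemLp (fun ω => e g ω - (e h ω + r * e k ω)) 2 P :=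
    (he.memLp g).sub ((he.memLp h).add ((he.memLp k).const_mul r))
  have hsq : ∫ ω, (e g ω - (e h ω + r * e k ω)) ^ 2 ∂P = 0 := by
    have i1 := he.integrable_mul g g
    have i2 := (he.integrable_mul g h).const_mul (-2)
    have i3 := (he.integrable_mul g k).const_mul (-2 * r)
    have i4 := he.integrable_mul h h
    have i5 := (he.integrable_mul h k).const_mul (2 * r)
    have i6 := (he.integrable_mul k k).const_mul (r ^ 2)
    have : (fun ω => (e g ω - (e h ω + r * e k ω)) ^ 2) = fun ω =>
        ((((e g ω * e g ω + -2 * (e g ω * e h ω)) + -2 * r * (e g ω * e k ω)) + e h ω * e h ω) +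
          2 * r * (e h ω * e k ω)) + r ^ 2 * (e k ω * e k ω) := by
      ext ω; ring
    rw [this, integral_add ((((i1.fun_add i2).fun_add i3).fun_add i4).fun_add i5) i6,
      integral_add (((i1.fun_add i2).fun_add i3).fun_add i4) i5,
      integral_add ((i1.fun_add i2).fun_add i3) i4, integral_add (i1.fun_add i2) i3, integral_add i1 i2]
    simp only [integral_const_mul, he.covariance, hg, inner_add_left, inner_add_right,
      real_inner_smul_left, real_inner_smul_right, real_inner_comm h k]
    ring
  have h0 := (integral_eq_zero_iff_of_nonneg (fun ω => sq_nonneg _) hmem.integrable_sq).1 hsq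
  filter_upwards [h0] with ω hω
  have := pow_eq_zero_iff two_ne_zero |>.1 hω
  linarith

/-! ### Tails of correlated Gaussian pairs -/

section Gaussian

variable {Ω : Type*} [MeasurableSpace Ω] {P : Measure Ω} [IsProbabilityMeasure P]

/-- Tail bound for a centered Gaussian vector of the plane with uncorrelated coordinates. -/
lemma gaussian_pair_tail {X Y : Ω → ℝ} (h : HasGaussianLaw (fun ω => (X ω, Y ω)) P)
    (hX0 : ∫ ω, X ω ∂P = 0) (hY0 : ∫ ω, Y ω ∂P = 0) (hXY : ∫ ω, X ω * Y ω ∂P = 0)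
    {l : ℝ} (hl : 0 < l) (hX : ∫ ω, X ω * X ω ∂P ≤ l) (hY : ∫ ω, Y ω * Y ω ∂P ≤ l)
    {t : ℝ} (ht : 0 ≤ t) :
    P.real {ω | t ^ 2 ≤ X ω ^ 2 + Y ω ^ 2} ≤ Real.exp (-(t ^ 2 / (2 * l))) := by
  have hgX := h.fst
  have hgY := h.snd
  have hind : IndepFun X Y P := by
    apply h.indepFun_of_covariance_eq_zero
    rw [covariance_eq_sub hgX.memLp_two hgY.memLp_two, hX0, hY0]
    simpa using hXY
  -- Writing each coordinate as a multiple of a standard Gaussian, with the standard deviation as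
  -- factor, also covers variance zero, where no density exists.
  have hlaw : ∀ {Z : Ω → ℝ}, HasGaussianLaw Z P → ∫ ω, Z ω ∂P = 0 → ∫ ω, Z ω * Z ω ∂P ≤ l →
      ∃ a : ℝ, a ^ 2 ≤ l ∧ P.map Z = (gaussianReal 0 1).map (a * ·) := by
    intro Z hZ hZ0 hZl
    refine ⟨√(Var[Z; P]), ?_, ?_⟩
    · rw [Real.sq_sqrt (variance_nonneg _ _),
        variance_of_integral_eq_zero hZ.aemeasurable hZ0]
      simpa [sq] using hZl
    · rw [hZ.map_eq_gaussianReal, gaussianReal_map_const_mul, hZ0, mul_zero, mul_one]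
      congr 1
      ext
      simp [Real.sq_sqrt (variance_nonneg _ _), variance_nonneg]
  obtain ⟨a, ha, hXa⟩ := hlaw hgX hX0 hX
  obtain ⟨b, hb, hYb⟩ := hlaw hgY hY0 hY
  have hmap := hind.map_prod_eq_prod_map_map hgX.aemeasurable hgY.aemeasurable
  rw [hXa, hYb, Measure.map_prod_map _ _ (by fun_prop) (by fun_prop)] at hmap
  have hS : MeasurableSet {z : ℝ × ℝ | t ^ 2 ≤ z.1 ^ 2 + z.2 ^ 2} :=
    measurableSet_le (by fun_prop) (by fun_prop)
  have h1 : P {ω | t ^ 2 ≤ X ω ^ 2 + Y ω ^ 2} =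
      ((gaussianReal 0 1).prod (gaussianReal 0 1))
        {z : ℝ × ℝ | t ^ 2 ≤ (a * z.1) ^ 2 + (b * z.2) ^ 2} := by
    have h2 := Measure.map_apply_of_aemeasurable h.aemeasurable hS
    rw [hmap, Measure.map_apply (by fun_prop) hS] at h2
    exact h2.symm
  have h3 : P {ω | t ^ 2 ≤ X ω ^ 2 + Y ω ^ 2} ≤
      ENNReal.ofReal (Real.exp (-(t ^ 2 / (2 * l)))) := by
    have hsl : (√l) ^ 2 = l := Real.sq_sqrt hl.le
    have h4 := gaussianReal_prod_tail (t / √l) (by positivity)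
    rw [show -(t / √l) ^ 2 / 2 = -(t ^ 2 / (2 * l)) by
      rw [div_pow, hsl]; field_simp] at h4
    rw [h1, ← h4]
    -- Both scale factors have square at most `l`, so the ellipse condition implies that the
    -- standard vector lies outside the disc of radius `t / √l`.
    apply measure_mono
    intro z hz
    simp only [mem_ofPred_eq] at hz ⊢
    rw [div_pow, hsl, div_le_iff₀ hl]
    nlinarith [mul_le_mul_of_nonneg_left ha (sq_nonneg z.1),
      mul_le_mul_of_nonneg_left hb (sq_nonneg z.2)]
  exact ENNReal.toReal_le_of_le_ofReal (Real.exp_pos _).le h3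

/-- A rotation angle that decorrelates a quadratic form. -/
lemma exists_rotation (p r o : ℝ) : ∃ c d : ℝ, c ^ 2 + d ^ 2 = 1 ∧
    c * d * p + (c ^ 2 - d ^ 2) * o - c * d * r = 0 ∧
    2 * (c ^ 2 * p - 2 * c * d * o + d ^ 2 * r) = p + r + ‖((p - r : ℝ) + 2 * o * Complex.I : ℂ)‖ ∧
    2 * (d ^ 2 * p + 2 * c * d * o + c ^ 2 * r) = p + r - ‖((p - r : ℝ) + 2 * o * Complex.I : ℂ)‖ := by
  set z : ℂ := (p - r : ℝ) + 2 * o * Complex.I with hz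
  have hre : ‖z‖ * Real.cos z.arg = p - r := by
    rw [Complex.norm_mul_cos_arg, hz]; simp
  have him : ‖z‖ * Real.sin z.arg = 2 * o := by
    rw [Complex.norm_mul_sin_arg, hz]; simp
  -- A rotation by `θ` turns the pair (difference of diagonal entries, twice the off-diagonal
  -- entry), read as the complex number `z`, by `2θ`. Half the argument of `z` makes it real and
  -- nonnegative, so the diagonal entries become the eigenvalues `(p + r ± ‖z‖) / 2`.
  set θ := z.arg / 2 with hθ
  have h2 : z.arg = 2 * θ := by rw [hθ]; ring
  rw [h2, Real.cos_two_mul] at hre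
  rw [h2, Real.sin_two_mul] at him
  have hcs := Real.sin_sq_add_cos_sq θ
  have hs2 : Real.sin θ ^ 2 = 1 - Real.cos θ ^ 2 := by linarith
  refine ⟨Real.cos θ, -Real.sin θ, by linarith, ?_, ?_, ?_⟩
  · have : p = r + ‖z‖ * (2 * Real.cos θ ^ 2 - 1) := by linarith
    have ho : o = ‖z‖ * (Real.sin θ * Real.cos θ) := by linarith
    rw [neg_sq, hs2, this, ho]; ring
  · have : p = r + ‖z‖ * (2 * Real.cos θ ^ 2 - 1) := by linarith
    have ho : o = ‖z‖ * (Real.sin θ * Real.cos θ) := by linarith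
    rw [neg_sq, this, ho]
    linear_combination (2 * r + 4 * ‖z‖ * Real.cos θ ^ 2) * hcs
  · have : p = r + ‖z‖ * (2 * Real.cos θ ^ 2 - 1) := by linarith
    have ho : o = ‖z‖ * (Real.sin θ * Real.cos θ) := by linarith
    rw [neg_sq, this, ho]
    linear_combination (2 * r - 2 * ‖z‖) * hcs

variable {v : ℝ} {e : Lp ℝ 2 (volume : Measure ℝ) → Ω → ℝ}

/-- Tails of the modulus of the white noise evaluated at a pair of square integrable functions. -/
lemma IsWhiteNoise.tail (he : IsWhiteNoise P v e) (hv : 0 < v)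
    (h k : Lp ℝ 2 (volume : Measure ℝ)) {L : ℝ} (hL : 0 < L)
    (hhk : inner ℝ h h + inner ℝ k k +
      ‖((inner ℝ h h - inner ℝ k k : ℝ) + 2 * (inner ℝ h k : ℝ) * Complex.I : ℂ)‖ ≤ L)
    {t : ℝ} (ht : 0 ≤ t) :
    P.real {ω | t ^ 2 ≤ e h ω ^ 2 + e k ω ^ 2} ≤ Real.exp (-(t ^ 2 / (v * L))) := by
  obtain ⟨c, d, hcd, h0, h1, h2⟩ := exists_rotation (inner ℝ h h) (inner ℝ k k) (inner ℝ h k)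
  set X : Ω → ℝ := fun ω => c * e h ω - d * e k ω
  set Y : Ω → ℝ := fun ω => d * e h ω + c * e k ω
  have hG : HasGaussianLaw (fun ω => (X ω, Y ω)) P := by
    have h3 := (he.gaussian.hasGaussianLaw_prodMk (s := h) (t := k)).map
      (((c • ContinuousLinearMap.fst ℝ ℝ ℝ - d • ContinuousLinearMap.snd ℝ ℝ ℝ)).prod
        ((d • ContinuousLinearMap.fst ℝ ℝ ℝ + c • ContinuousLinearMap.snd ℝ ℝ ℝ)))
    convert! h3 using 1
  have hih := (he.memLp h).integrable one_le_two
  have hik := (he.memLp k).integrable one_le_two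
  have hX0 : ∫ ω, X ω ∂P = 0 := by
    simp only [X]
    rw [integral_sub (hih.const_mul _) (hik.const_mul _), integral_const_mul, integral_const_mul,
      he.mean_zero, he.mean_zero]
    ring
  have hY0 : ∫ ω, Y ω ∂P = 0 := by
    simp only [Y]
    rw [integral_add (hih.const_mul _) (hik.const_mul _), integral_const_mul, integral_const_mul,
      he.mean_zero, he.mean_zero]
    ring
  have key : ∀ a b g : ℝ, ∫ ω, (a * (e h ω * e h ω) + b * (e h ω * e k ω) + g * (e k ω * e k ω)) ∂P
      = v * (a * inner ℝ h h + b * inner ℝ h k + g * inner ℝ k k) := by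
    intro a b g
    have i1 := (he.integrable_mul h h).const_mul a
    have i2 := (he.integrable_mul h k).const_mul b
    have i3 := (he.integrable_mul k k).const_mul g
    rw [integral_add (i1.fun_add i2) i3, integral_add i1 i2, integral_const_mul, integral_const_mul,
      integral_const_mul, he.covariance, he.covariance, he.covariance]
    ring
  have hXY : ∫ ω, X ω * Y ω ∂P = 0 := by
    have := key (c * d) (c ^ 2 - d ^ 2) (-(c * d))
    rw [show (fun ω => X ω * Y ω) = fun ω => (c * d * (e h ω * e h ω) +
      (c ^ 2 - d ^ 2) * (e h ω * e k ω) + -(c * d) * (e k ω * e k ω)) by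
        ext ω; simp only [X, Y]; ring, this]
    linear_combination v * h0
  -- `X` lies along the axis of the larger eigenvalue; the smaller one, for `Y`, is bounded by the
  -- same number because the norm is nonnegative.
  have hX : ∫ ω, X ω * X ω ∂P ≤ v * L / 2 := by
    have := key (c ^ 2) (-(2 * c * d)) (d ^ 2)
    rw [show (fun ω => X ω * X ω) = fun ω => (c ^ 2 * (e h ω * e h ω) +
      -(2 * c * d) * (e h ω * e k ω) + d ^ 2 * (e k ω * e k ω)) by
        ext ω; simp only [X]; ring, this]
    have h4 : c ^ 2 * inner ℝ h h + -(2 * c * d) * inner ℝ h k + d ^ 2 * inner ℝ k k ≤ L / 2 := by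
      linarith
    nlinarith
  have hY : ∫ ω, Y ω * Y ω ∂P ≤ v * L / 2 := by
    have := key (d ^ 2) (2 * c * d) (c ^ 2)
    rw [show (fun ω => Y ω * Y ω) = fun ω => (d ^ 2 * (e h ω * e h ω) +
      (2 * c * d) * (e h ω * e k ω) + c ^ 2 * (e k ω * e k ω)) by
        ext ω; simp only [Y]; ring, this]
    have h5 := norm_nonneg ((inner ℝ h h - inner ℝ k k : ℝ) + 2 * (inner ℝ h k : ℝ) * Complex.I : ℂ)
    have h4 : d ^ 2 * inner ℝ h h + (2 * c * d) * inner ℝ h k + c ^ 2 * inner ℝ k k ≤ L / 2 := by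
      linarith
    nlinarith
  have := gaussian_pair_tail hG hX0 hY0 hXY (l := v * L / 2) (by positivity) hX hY ht
  rw [show 2 * (v * L / 2) = v * L by ring] at this
  convert this using 5 with ω
  simp only [X, Y]
  -- The rotation preserves the sum of squares.
  linear_combination -(e h ω ^ 2 + e k ω ^ 2) * hcd

end Gaussian

/-! ### Pairing the noise with complex test functions -/

section Pairing

lemma toL2_of_memLp {h : ℝ → ℝ} (hh : MemLp h 2 (volume : Measure ℝ)) : toL2 h = hh.toLp h := by
  rw [toL2, dif_pos hh]

lemma toL2_add_smul {h k : ℝ → ℝ} (hh : MemLp h 2 (volume : Measure ℝ))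
    (hk : MemLp k 2 (volume : Measure ℝ)) (r : ℝ) :
    toL2 (fun x => h x + r * k x) = toL2 h + r • toL2 k := by
  rw [toL2_of_memLp hh, toL2_of_memLp hk, toL2_of_memLp (h := fun x => h x + r * k x) (hh.add (hk.const_mul r))]
  rfl

lemma inner_toL2 {h k : ℝ → ℝ} (hh : MemLp h 2 (volume : Measure ℝ))
    (hk : MemLp k 2 (volume : Measure ℝ)) :
    inner ℝ (toL2 h) (toL2 k) = ∫ x, h x * k x := by
  rw [toL2_of_memLp hh, toL2_of_memLp hk, L2.inner_def]
  apply integral_congr_ae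
  filter_upwards [hh.coeFn_toLp, hk.coeFn_toLp] with x h1 h2
  rw [h1, h2]
  simp [mul_comm]

lemma normSq_pairing {Ω : Type*}
    (e : Lp ℝ 2 (volume : Measure ℝ) → Ω → ℝ) (u : ℝ → ℂ) (ω : Ω) :
    ‖pairing e u ω‖ ^ 2 = e (toL2 fun x => (u x).re) ω ^ 2 + e (toL2 fun x => (u x).im) ω ^ 2 := by
  rw [← Complex.normSq_eq_norm_sq, pairing, Complex.normSq_apply]
  simp
  ring

/-- The pairing is almost surely antilinear in the test function. This turns the noise in `∂_b W_g -
2πi μ W_g` into a single Gaussian pairing, for which cancellation can be seen in the test function.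
-/
lemma IsWhiteNoise.pairing_add_mul {Ω : Type*} [MeasurableSpace Ω] {P : Measure Ω} {v : ℝ}
    {e : Lp ℝ 2 (volume : Measure ℝ) → Ω → ℝ} (he : IsWhiteNoise P v e)
    {u u' : ℝ → ℂ}
    (hu : MemLp u 2 (volume : Measure ℝ)) (hu' : MemLp u' 2 (volume : Measure ℝ)) (r : ℝ) :
    pairing e (fun x => u x + r * Complex.I * u' x) =ᵐ[P]
      fun ω => pairing e u ω - r * Complex.I * pairing e u' ω := by
  have hre := hu.re
  have him := hu.im
  have hre' := hu'.re
  have him' := hu'.im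
  simp only [RCLike.re_eq_complex_re, RCLike.im_eq_complex_im] at hre him hre' him'
  filter_upwards [he.add_smul (toL2 fun x => (u x).re) (toL2 fun x => (u' x).im) (-r),
    he.add_smul (toL2 fun x => (u x).im) (toL2 fun x => (u' x).re) r] with ω h1 h2
  rw [← toL2_add_smul hre him'] at h1
  rw [← toL2_add_smul him hre'] at h2
  have e1 : (fun x => (u x + r * Complex.I * u' x).re) = fun x => (u x).re + -r * (u' x).im := by
    ext x; simp
  have e2 : (fun x => (u x + r * Complex.I * u' x).im) = fun x => (u x).im + r * (u' x).re := by
    ext x; simp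
  simp only [pairing]
  rw [e1, e2, h1, h2]
  push_cast
  linear_combination (-(r : ℂ) * (e (toL2 fun x => (u' x).im) ω)) * Complex.I_sq

variable {Ω : Type*} [MeasurableSpace Ω] {P : Measure Ω} [IsProbabilityMeasure P]
  {v : ℝ} {e : Lp ℝ 2 (volume : Measure ℝ) → Ω → ℝ}

/-- Tail bound for the pairing of the white noise with a complex test function. -/
lemma IsWhiteNoise.pairing_tail (he : IsWhiteNoise P v e) (hv : 0 < v) {u : ℝ → ℂ}
    (hu : MemLp u 2 (volume : Measure ℝ)) {L : ℝ} (hL : 0 < L)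
    (huL : (∫ x, ‖u x‖ ^ 2) + ‖∫ x, u x ^ 2‖ ≤ L) {t : ℝ} (ht : 0 ≤ t) :
    P.real {ω | t ≤ ‖pairing e u ω‖} ≤ Real.exp (-(t ^ 2 / (v * L))) := by
  have hre := hu.re
  have him := hu.im
  simp only [RCLike.re_eq_complex_re, RCLike.im_eq_complex_im] at hre him
  have i1 : Integrable (fun x => (u x).re * (u x).re) := hre.integrable_mul hre
  have i2 : Integrable (fun x => (u x).im * (u x).im) := him.integrable_mul him
  have i3 : Integrable (fun x => (u x).re * (u x).im) := hre.integrable_mul him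
  have e1 : (∫ x, ‖u x‖ ^ 2) = (∫ x, (u x).re * (u x).re) + ∫ x, (u x).im * (u x).im := by
    rw [← integral_add i1 i2]
    congr 1 with x
    rw [← Complex.normSq_eq_norm_sq, Complex.normSq_apply]
  -- The integral of `u²` encodes the anisotropy of the covariance: it is exactly the complex number
  -- whose norm enters `IsWhiteNoise.tail`.
  have e2 : (∫ x, u x ^ 2) = (((∫ x, (u x).re * (u x).re) - ∫ x, (u x).im * (u x).im : ℝ) : ℂ) +
      2 * ((∫ x, (u x).re * (u x).im : ℝ) : ℂ) * Complex.I := by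
    rw [← integral_sub i1 i2, ← integral_complex_ofReal, ← integral_complex_ofReal,
      mul_comm (2 : ℂ), mul_assoc, ← integral_mul_const, ← integral_add]
    · congr 1 with x
      apply Complex.ext
      · simp [sq]
      · simp [sq]; ring
    · exact (i1.sub i2).ofReal
    · exact i3.ofReal.mul_const _
  have h := he.tail hv (toL2 fun x => (u x).re) (toL2 fun x => (u x).im) hL (by
    rw [inner_toL2 hre hre, inner_toL2 him him, inner_toL2 hre him, ← e1]
    rw [e2] at huL
    exact huL) ht
  convert h using 4 with ω
  rw [← normSq_pairing]
  exact (sq_le_sq₀ ht (norm_nonneg _)).symm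

end Pairing

lemma norm_fourier_le (w : ℝ → ℂ) (ξ : ℝ) : ‖𝓕 w ξ‖ ≤ ∫ x, ‖w x‖ :=
  VectorFourier.norm_fourierIntegral_le_integral_norm _ _ _ _ _

/-! ### Size of the mother packet and of its derivative -/

section PacketSize

variable {ε B : ℝ} {m : ℕ} {w : ℝ → ℂ}

lemma PacketSize.integral_norm_le (hB : PacketSize B w) (hw : Integrable w) :
    ∫ x, ‖w x‖ ≤ B := by
  refine (integral_mono hw.norm hB.integrable_moment fun x => ?_).trans hB.moment_le
  nlinarith [norm_nonneg (w x), mul_nonneg (sq_nonneg x) (norm_nonneg (w x))]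

lemma PacketSize.integrable_abs_mul (hB : PacketSize B w) (hw : Integrable w) :
    Integrable fun x : ℝ => |x| * ‖w x‖ := by
  refine hB.integrable_moment.mono' (by have := hw.1; fun_prop) (ae_of_all _ fun x => ?_)
  rw [Real.norm_of_nonneg (by positivity)]
  gcongr
  nlinarith [sq_abs x, sq_nonneg (|x| - 1)]

lemma PacketSize.integral_abs_mul_le (hB : PacketSize B w) (hw : Integrable w) :
    ∫ x : ℝ, |x| * ‖w x‖ ≤ B := by
  refine (integral_mono (hB.integrable_abs_mul hw) hB.integrable_moment fun x => ?_).trans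
    hB.moment_le
  have : |x| ≤ 1 + x ^ 2 := by nlinarith [sq_abs x, sq_nonneg (|x| - 1)]
  exact mul_le_mul_of_nonneg_right this (norm_nonneg _)

lemma PacketSize.integrable_sq_mul (hB : PacketSize B w) (hw : Integrable w) :
    Integrable fun x : ℝ => x ^ 2 * ‖w x‖ := by
  refine hB.integrable_moment.mono' (by have := hw.1; fun_prop) (ae_of_all _ fun x => ?_)
  rw [Real.norm_of_nonneg (by positivity)]
  gcongr
  linarith

lemma PacketSize.integral_sq_mul_le (hB : PacketSize B w) (hw : Integrable w) :
    ∫ x : ℝ, x ^ 2 * ‖w x‖ ≤ B := by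
  refine (integral_mono (hB.integrable_sq_mul hw) hB.integrable_moment fun x => ?_).trans
    hB.moment_le
  exact mul_le_mul_of_nonneg_right (by linarith) (norm_nonneg _)

/-- A nonpositive `B` would force `∫ |w| ≤ 0`, against `ŵ(0) ≠ 0`. -/
lemma PacketSize.pos (hB : PacketSize B w) (hw : IsMotherPacket ε m w) : 0 < B :=
  (norm_pos_iff.2 (hw.fourier_ne_zero 0 (by simp))).trans_le
    ((norm_fourier_le w 0).trans (hB.integral_norm_le hw.integrable))

lemma PacketSize.mono {B' : ℝ} (hB : PacketSize B w) (h0 : 0 < B) (h : B ≤ B') :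
    PacketSize B' w where
  integrable_moment := hB.integrable_moment
  moment_le := hB.moment_le.trans h
  integrable_deriv := hB.integrable_deriv
  deriv_le := hB.deriv_le.trans h
  inv_le_normSq := (inv_anti₀ h0 h).trans hB.inv_le_normSq

/-- A bound for `∫ (1 + |ξ|) |ŵ(ξ)| dξ`. -/
noncomputable def fourierMass (B : ℝ) (m : ℕ) : ℝ :=
  (B * 2 ^ m + 1) * ∫ ξ : ℝ, (1 + ‖ξ‖) ^ (-2 : ℝ)

lemma integrable_japanese : Integrable fun ξ : ℝ => (1 + ‖ξ‖) ^ (-2 : ℝ) :=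
  integrable_one_add_norm (by simp)

lemma fourierMass_nonneg (hB : 0 ≤ B) : 0 ≤ fourierMass B m :=
  mul_nonneg (by positivity) (integral_nonneg fun ξ => by positivity)

/-- On `|ξ| ≤ 1` the trivial bound `|ŵ| ≤ B` costs `2^m`; beyond, the assumed decay applies. Three
powers of decay pay for the weight `1 + |ξ|` and leave an integrable square. -/
lemma IsMotherPacket.fourier_le (hw : IsMotherPacket ε m w) (hB : PacketSize B w) (hε : ε < 1)
    (hm : 3 ≤ m) (ξ : ℝ) :
    (1 + |ξ|) * ‖𝓕 w ξ‖ ≤ (B * 2 ^ m + 1) * (1 + ‖ξ‖) ^ (-2 : ℝ) := by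
  have hB0 := hB.pos hw
  have h1 : (1 : ℝ) ≤ 1 + |ξ| := by linarith [abs_nonneg ξ]
  rw [Real.rpow_neg (by positivity), Real.norm_eq_abs ξ, ← div_eq_mul_inv,
    show (2 : ℝ) = ((2 : ℕ) : ℝ) by norm_num, Real.rpow_natCast, le_div_iff₀ (by positivity),
    mul_assoc, mul_comm, mul_assoc, ← pow_succ]
  have h2 : (1 + |ξ|) ^ (2 + 1) ≤ (1 + |ξ|) ^ m := pow_le_pow_right₀ h1 hm
  have h3 : ‖𝓕 w ξ‖ * (1 + |ξ|) ^ m ≤ B * 2 ^ m + 1 := by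
    rcases le_or_gt |ξ| 1 with h | h
    · have : ‖𝓕 w ξ‖ * (1 + |ξ|) ^ m ≤ B * 2 ^ m := by
        gcongr
        · exact (norm_fourier_le w ξ).trans (hB.integral_norm_le hw.integrable)
        · linarith
      linarith
    · have := hw.fourier_decay ξ h
      rw [le_div_iff₀ (by positivity)] at this
      nlinarith [show 0 < B * 2 ^ m by positivity]
  exact (mul_le_mul_of_nonneg_left h2 (norm_nonneg _)).trans (by exact_mod_cast h3)

lemma IsMotherPacket.continuous_fourier (hw : IsMotherPacket ε m w) : Continuous (𝓕 w) :=
  hw.fourier_smooth.continuous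

lemma IsMotherPacket.integrable_fourier (hw : IsMotherPacket ε m w) (hB : PacketSize B w)
    (hε : ε < 1) (hm : 3 ≤ m) : Integrable (𝓕 w) := by
  refine (integrable_japanese.const_mul (B * 2 ^ m + 1)).mono'
    hw.continuous_fourier.aestronglyMeasurable (ae_of_all _ fun ξ => ?_)
  refine le_trans ?_ (hw.fourier_le hB hε hm ξ)
  nlinarith [norm_nonneg (𝓕 w ξ), mul_nonneg (abs_nonneg ξ) (norm_nonneg (𝓕 w ξ))]

lemma IsMotherPacket.integrable_abs_mul_fourier (hw : IsMotherPacket ε m w) (hB : PacketSize B w)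
    (hε : ε < 1) (hm : 3 ≤ m) : Integrable fun ξ => |ξ| * ‖𝓕 w ξ‖ := by
  refine (integrable_japanese.const_mul (B * 2 ^ m + 1)).mono'
    (continuous_abs.mul hw.continuous_fourier.norm).aestronglyMeasurable (ae_of_all _ fun ξ => ?_)
  rw [Real.norm_of_nonneg (by positivity)]
  refine le_trans ?_ (hw.fourier_le hB hε hm ξ)
  nlinarith [norm_nonneg (𝓕 w ξ), mul_nonneg (abs_nonneg ξ) (norm_nonneg (𝓕 w ξ))]

lemma IsMotherPacket.integral_fourier_le (hw : IsMotherPacket ε m w) (hB : PacketSize B w)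
    (hε : ε < 1) (hm : 3 ≤ m) : ∫ ξ, ‖𝓕 w ξ‖ ≤ fourierMass B m := by
  rw [fourierMass, ← integral_const_mul]
  refine integral_mono (hw.integrable_fourier hB hε hm).norm (integrable_japanese.const_mul _)
    fun ξ => ?_
  refine le_trans ?_ (hw.fourier_le hB hε hm ξ)
  nlinarith [norm_nonneg (𝓕 w ξ), mul_nonneg (abs_nonneg ξ) (norm_nonneg (𝓕 w ξ))]

lemma IsMotherPacket.integral_abs_mul_fourier_le (hw : IsMotherPacket ε m w) (hB : PacketSize B w)
    (hε : ε < 1) (hm : 3 ≤ m) : ∫ ξ, |ξ| * ‖𝓕 w ξ‖ ≤ fourierMass B m := by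
  rw [fourierMass, ← integral_const_mul]
  refine integral_mono (hw.integrable_abs_mul_fourier hB hε hm) (integrable_japanese.const_mul _)
    fun ξ => ?_
  refine le_trans ?_ (hw.fourier_le hB hε hm ξ)
  nlinarith [norm_nonneg (𝓕 w ξ), mul_nonneg (abs_nonneg ξ) (norm_nonneg (𝓕 w ξ))]

lemma norm_le_integral_norm_fourier {g : ℝ → ℂ} (hc : Continuous g) (hg : Integrable g)
    (hg' : Integrable (𝓕 g)) (x : ℝ) : ‖g x‖ ≤ ∫ ξ, ‖𝓕 g ξ‖ := by
  conv_lhs => rw [← hc.fourierInv_fourier_eq hg hg', Real.fourierInv_eq_fourier_comp_neg]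
  refine (norm_fourier_le _ x).trans (le_of_eq ?_)
  exact integral_neg_eq_self (fun ξ => ‖𝓕 g ξ‖) volume

lemma IsMotherPacket.continuous (hw : IsMotherPacket ε m w) : Continuous w :=
  hw.contDiff.continuous

lemma IsMotherPacket.differentiable (hw : IsMotherPacket ε m w) (hm : 3 ≤ m) :
    Differentiable ℝ w :=
  hw.contDiff.differentiable (by exact_mod_cast (by omega : m ≠ 0))

lemma IsMotherPacket.continuous_deriv (hw : IsMotherPacket ε m w) (hm : 3 ≤ m) :
    Continuous (deriv w) :=
  hw.contDiff.continuous_deriv (by exact_mod_cast (by omega : 1 ≤ m))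

lemma IsMotherPacket.norm_le (hw : IsMotherPacket ε m w) (hB : PacketSize B w)
    (hε : ε < 1) (hm : 3 ≤ m) (x : ℝ) : ‖w x‖ ≤ fourierMass B m :=
  (norm_le_integral_norm_fourier hw.continuous hw.integrable
    (hw.integrable_fourier hB hε hm) x).trans (hw.integral_fourier_le hB hε hm)

lemma IsMotherPacket.norm_deriv_le (hw : IsMotherPacket ε m w) (hB : PacketSize B w)
    (hε : ε < 1) (hm : 3 ≤ m) (x : ℝ) : ‖deriv w x‖ ≤ 2 * Real.pi * fourierMass B m := by
  have hF := Real.fourier_deriv hw.integrable (hw.differentiable hm) hB.integrable_deriv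
  have hn : ∀ ξ : ℝ, ‖𝓕 (deriv w) ξ‖ = 2 * Real.pi * (|ξ| * ‖𝓕 w ξ‖) := by
    intro ξ
    rw [hF]
    simp [abs_of_pos Real.pi_pos]
    ring
  have hi : Integrable (𝓕 (deriv w)) := by
    have hc : Continuous (𝓕 (deriv w)) := by
      rw [hF]
      have := hw.continuous_fourier
      fun_prop
    rw [← integrable_norm_iff hc.aestronglyMeasurable]
    simp only [hn]
    exact (hw.integrable_abs_mul_fourier hB hε hm).const_mul _
  refine (norm_le_integral_norm_fourier (hw.continuous_deriv hm) hB.integrable_deriv hi x).trans ?_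
  simp only [hn]
  rw [integral_const_mul]
  exact mul_le_mul_of_nonneg_left (hw.integral_abs_mul_fourier_le hB hε hm) (by positivity)

lemma integrable_sq_of_bounded {g : ℝ → ℂ} (hc : Continuous g) (hg : Integrable g) {A : ℝ}
    (hA : ∀ x, ‖g x‖ ≤ A) : Integrable fun x => ‖g x‖ ^ 2 := by
  refine (hg.norm.const_mul A).mono' (hc.norm.pow 2).aestronglyMeasurable (ae_of_all _ fun x => ?_)
  rw [Real.norm_of_nonneg (by positivity), sq]
  exact mul_le_mul_of_nonneg_right (hA x) (norm_nonneg _)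

/-- The size condition bounds `∫ |w|` and `∫ |w'|` but puts no upper bound on the `L²` norms. These
follow from this inequality, with the sup norms of `w` and `w'` supplied by Fourier inversion. -/
lemma integral_sq_le_of_bounded {g : ℝ → ℂ} (hc : Continuous g) (hg : Integrable g) {A : ℝ}
    (hA : ∀ x, ‖g x‖ ≤ A) : ∫ x, ‖g x‖ ^ 2 ≤ A * ∫ x, ‖g x‖ := by
  rw [← integral_const_mul]
  refine integral_mono (integrable_sq_of_bounded hc hg hA) (hg.norm.const_mul A) fun x => ?_
  simp only [sq]
  exact mul_le_mul_of_nonneg_right (hA x) (norm_nonneg _)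

lemma IsMotherPacket.normSq_le (hw : IsMotherPacket ε m w) (hB : PacketSize B w)
    (hε : ε < 1) (hm : 3 ≤ m) : normSqL2 w ≤ fourierMass B m * B :=
  (integral_sq_le_of_bounded hw.continuous hw.integrable (hw.norm_le hB hε hm)).trans
    (mul_le_mul_of_nonneg_left (hB.integral_norm_le hw.integrable)
      (fourierMass_nonneg (hB.pos hw).le))

lemma IsMotherPacket.normSq_deriv_le (hw : IsMotherPacket ε m w) (hB : PacketSize B w)
    (hε : ε < 1) (hm : 3 ≤ m) :
    ∫ x, ‖deriv w x‖ ^ 2 ≤ 2 * Real.pi * fourierMass B m * B := by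
  have h0 := fourierMass_nonneg (m := m) (hB.pos hw).le
  exact (integral_sq_le_of_bounded (hw.continuous_deriv hm) hB.integrable_deriv
    (hw.norm_deriv_le hB hε hm)).trans (mul_le_mul_of_nonneg_left hB.deriv_le (by positivity))

/-- The modulated square integral of a mother wave packet is small at high frequencies. -/
lemma IsMotherPacket.norm_integral_sq_modulated_le (hw : IsMotherPacket ε m w)
    (hB : PacketSize B w) (hε0 : 0 < ε) (hε : ε < 1) (hm : 3 ≤ m) {c : ℝ} (hc : 2 ≤ |c|) :
    ‖∫ y, w y ^ 2 * Complex.exp (2 * Real.pi * Complex.I * (c * y : ℝ))‖ ≤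
      2 * fourierMass B m * (ε / (1 + |c| / 2) ^ m) := by
  set g : ℝ → ℂ := fun y => w y * Complex.exp (2 * Real.pi * Complex.I * (c * y : ℝ)) with hg
  have hnorm : ∀ y : ℝ, ‖Complex.exp (2 * Real.pi * Complex.I * (c * y : ℝ))‖ = 1 := by
    intro y
    rw [show 2 * Real.pi * Complex.I * (c * y : ℝ) = ((2 * Real.pi * (c * y) : ℝ) : ℂ) * Complex.I
      by push_cast; ring, Complex.norm_exp_ofReal_mul_I]
  have hgi : Integrable g := by
    refine hw.integrable.norm.mono' ?_ (ae_of_all _ fun y => by simp only [hg, norm_mul, hnorm]; simp)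
    have := hw.continuous
    fun_prop
  have hFi := hw.integrable_fourier hB hε hm
  have hf : 𝓕 (fun ξ => 𝓕 w (-ξ)) = w := by
    rw [← Real.fourierInv_eq_fourier_comp_neg]
    exact hw.continuous.fourierInv_fourier_eq hw.integrable hFi
  have hFg : ∀ ξ, 𝓕 g ξ = 𝓕 w (ξ - c) := by
    intro ξ
    rw [Real.fourier_real_eq_integral_exp_smul, Real.fourier_real_eq_integral_exp_smul]
    congr 1 with y
    simp only [hg, smul_eq_mul]
    rw [mul_comm (w y), ← mul_assoc, ← Complex.exp_add]
    congr 2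
    push_cast
    ring
  -- Self-adjointness of the Fourier transform, with inversion applied to one factor `w`, turns the
  -- modulated integral of `w²` into a convolution of `ŵ` with itself.
  have hflip : ∫ y, 𝓕 (fun ξ => 𝓕 w (-ξ)) y • g y = ∫ ξ, 𝓕 w (-ξ) • 𝓕 g ξ := by
    have h := VectorFourier.integral_fourierIntegral_smul_eq_flip (L := innerₗ ℝ)
      Real.continuous_fourierChar continuous_inner (hFi.comp_neg) hgi
    rwa [flip_innerₗ] at h
  have heq : (∫ y, w y ^ 2 * Complex.exp (2 * Real.pi * Complex.I * (c * y : ℝ))) =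
      ∫ ξ, 𝓕 w (-ξ) * 𝓕 w (ξ - c) := by
    rw [hf] at hflip
    simp only [hFg, smul_eq_mul] at hflip
    rw [← hflip]
    congr 1 with y
    simp only [hg]
    ring
  rw [heq]
  set E := ε / (1 + |c| / 2) ^ m with hE
  have hE0 : 0 ≤ E := by positivity
  have hsmall : ∀ ξ, |c| / 2 < |ξ| → ‖𝓕 w ξ‖ ≤ E := by
    intro ξ hξ
    refine (hw.fourier_decay ξ (by linarith)).trans ?_
    rw [hE]
    gcongr
  have i1 : Integrable fun ξ => ‖𝓕 w (-ξ)‖ := hFi.comp_neg.norm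
  have i2 : Integrable fun ξ => ‖𝓕 w (ξ - c)‖ := (hFi.comp_sub_right c).norm
  -- The points `-ξ` and `ξ - c` sum to `-c`, so one of them has modulus greater than `|c| / 2 ≥ 1`,
  -- where the decay of `ŵ` holds. The only exception is `ξ = c / 2`.
  have hpt : ∀ᵐ ξ : ℝ, ‖𝓕 w (-ξ) * 𝓕 w (ξ - c)‖ ≤ E * (‖𝓕 w (-ξ)‖ + ‖𝓕 w (ξ - c)‖) := by
    filter_upwards [Measure.ae_ne volume (c / 2)] with ξ hξ
    rw [norm_mul]
    have n1 := norm_nonneg (𝓕 w (-ξ))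
    have n2 := norm_nonneg (𝓕 w (ξ - c))
    rcases lt_or_ge (|c| / 2) |-ξ| with h | h
    · have := hsmall _ h
      nlinarith [mul_nonneg hE0 n1]
    · have : |c| / 2 < |ξ - c| := by
        by_contra! h'
        apply hξ
        rw [abs_neg] at h
        rcases abs_cases c with ⟨h1, _⟩ | ⟨h1, _⟩ <;> rcases abs_cases ξ with ⟨h2, _⟩ | ⟨h2, _⟩ <;>
          rcases abs_cases (ξ - c) with ⟨h3, _⟩ | ⟨h3, _⟩ <;> linarith
      have := hsmall _ this
      nlinarith [mul_nonneg hE0 n2]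
  calc ‖∫ ξ, 𝓕 w (-ξ) * 𝓕 w (ξ - c)‖ ≤ ∫ ξ, E * (‖𝓕 w (-ξ)‖ + ‖𝓕 w (ξ - c)‖) :=
        norm_integral_le_of_norm_le ((i1.add i2).const_mul E) hpt
    _ = E * ((∫ ξ, ‖𝓕 w ξ‖) + ∫ ξ, ‖𝓕 w ξ‖) := by
        rw [integral_const_mul, integral_add i1 i2, integral_neg_eq_self (fun ξ => ‖𝓕 w ξ‖) volume,
          integral_sub_right_eq_self (fun ξ => ‖𝓕 w ξ‖) c]
    _ ≤ 2 * fourierMass B m * E := by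
        have := hw.integral_fourier_le hB hε hm
        nlinarith

end PacketSize

/-! ### Change of variables from the mother packet to `w_{ab}` -/

section Rescaling

lemma norm_exp_two_pi_I (x : ℝ) : ‖Complex.exp (2 * Real.pi * Complex.I * (x : ℝ))‖ = 1 := by
  rw [show 2 * Real.pi * Complex.I * (x : ℂ) = ((2 * Real.pi * x : ℝ) : ℂ) * Complex.I
      by push_cast; ring, Complex.norm_exp_ofReal_mul_I]

lemma integral_comp_rescale {F : Type*} [NormedAddCommGroup F] [NormedSpace ℝ F] (G : ℝ → F)
    {l : ℝ} (hl : 0 < l) (b : ℝ) : ∫ x, G (l * (x - b)) = l⁻¹ • ∫ y, G y := by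
  rw [integral_sub_right_eq_self (fun x => G (l * x)) b, Measure.integral_comp_mul_left,
    abs_of_pos (inv_pos.2 hl)]

lemma integrable_comp_rescale {F : Type*} [NormedAddCommGroup F] {G : ℝ → F} (hG : Integrable G)
    {l : ℝ} (hl : 0 < l) (b : ℝ) : Integrable fun x => G (l * (x - b)) :=
  (hG.comp_mul_left' hl.ne').comp_sub_right b

variable {g : ℝ → ℂ} {s a b : ℝ}

lemma norm_packet (g : ℝ → ℂ) (s a b x : ℝ) :
    ‖packet g s a b x‖ = |a| ^ (s / 2) * ‖g (|a| ^ s * (x - b))‖ := by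
  rw [packet, norm_mul, norm_mul, norm_exp_two_pi_I, mul_one, Complex.norm_real,
    Real.norm_of_nonneg (by positivity)]

lemma continuous_packet (hg : Continuous g) : Continuous (packet g s a b) := by
  unfold packet
  fun_prop

lemma rpow_half_sq (a s : ℝ) : (|a| ^ (s / 2)) ^ 2 = |a| ^ s := by
  rw [← Real.rpow_natCast, ← Real.rpow_mul (abs_nonneg a)]
  congr 1
  push_cast
  ring

lemma integrable_normSq_packet (ha : a ≠ 0) (hg : Integrable fun x => ‖g x‖ ^ 2) :
    Integrable fun x => ‖packet g s a b x‖ ^ 2 := by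
  have h := (integrable_comp_rescale hg (Real.rpow_pos_of_pos (abs_pos.2 ha) s) b).const_mul
    ((|a| ^ (s / 2)) ^ 2)
  simpa only [norm_packet, mul_pow] using h

lemma memLp_packet (ha : a ≠ 0) (hc : Continuous g) (hg : Integrable fun x => ‖g x‖ ^ 2) :
    MemLp (packet g s a b) 2 volume :=
  (memLp_two_iff_integrable_sq_norm (continuous_packet hc).aestronglyMeasurable).2
    (integrable_normSq_packet ha hg)

lemma integral_normSq_packet (ha : a ≠ 0) : ∫ x, ‖packet g s a b x‖ ^ 2 = ∫ x, ‖g x‖ ^ 2 := by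
  have hl := Real.rpow_pos_of_pos (abs_pos.2 ha) s
  simp only [norm_packet, mul_pow, rpow_half_sq]
  rw [integral_const_mul, integral_comp_rescale (fun y => ‖g y‖ ^ 2) hl b, smul_eq_mul,
    mul_inv_cancel_left₀ hl.ne']

/-- Squaring without conjugation doubles the carrier frequency instead of removing it. After
rescaling, this leaves a modulation of frequency modulus `2|a|^{1-s}`, which is high for large
`|a|`. -/
lemma integral_sq_packet (ha : a ≠ 0) : ∫ x, packet g s a b x ^ 2 =
    ∫ y, g y ^ 2 * Complex.exp (2 * Real.pi * Complex.I * (2 * a * (|a| ^ s)⁻¹ * y : ℝ)) := by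
  have hl := Real.rpow_pos_of_pos (abs_pos.2 ha) s
  have h := integral_comp_rescale (fun y => g y ^ 2 * Complex.exp (2 * Real.pi * Complex.I *
    (2 * a * (|a| ^ s)⁻¹ * y : ℝ))) hl b
  rw [← smul_right_inj hl.ne', smul_inv_smul₀ hl.ne'] at h
  rw [← h, ← integral_smul]
  congr 1 with x
  rw [packet, mul_pow, mul_pow, ← Complex.ofReal_pow, rpow_half_sq, Complex.real_smul,
    ← Complex.exp_nat_mul, mul_assoc]
  congr 3
  have : 2 * a * (|a| ^ s)⁻¹ * (|a| ^ s * (x - b)) = 2 * ((x - b) * a) := by field_simp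
  rw [this]
  push_cast
  ring

lemma hasDerivAt_packet_center (hg : Differentiable ℝ g) (x : ℝ) :
    HasDerivAt (fun b' => packet g s a b' x)
      (-(2 * Real.pi * Complex.I * a) * packet g s a b x -
        ((|a| ^ s : ℝ) : ℂ) * packet (deriv g) s a b x) b := by
  have h1 : HasDerivAt (fun b' : ℝ => |a| ^ s * (x - b')) (-(|a| ^ s)) b := by
    simpa using ((hasDerivAt_id b).const_sub x).const_mul (|a| ^ s)
  have h2 := (hg (|a| ^ s * (x - b))).hasDerivAt.scomp b h1
  have h3 : HasDerivAt (fun b' : ℝ => (x - b') * a) (-a) b := by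
    simpa using ((hasDerivAt_id b).const_sub x).mul_const a
  have h4 := (h3.ofReal_comp.const_mul (2 * Real.pi * Complex.I : ℂ)).cexp
  have h5 := ((h2.const_mul ((|a| ^ (s / 2) : ℝ) : ℂ)).mul h4)
  refine h5.congr_deriv ?_
  simp only [packet, Function.comp, Complex.real_smul]
  push_cast
  ring

lemma packetDeriv_eq (hg : Differentiable ℝ g) (x : ℝ) :
    packetDeriv g s a b x = -(2 * Real.pi * Complex.I * a) * packet g s a b x -
        ((|a| ^ s : ℝ) : ℂ) * packet (deriv g) s a b x :=
  (hasDerivAt_packet_center hg x).deriv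

end Rescaling

/-! ### Wave packet coefficients of a single component -/

section Component

variable {M ν s a b h : ℝ} {α φ : ℝ → ℝ} {ε B : ℝ} {m : ℕ} {w : ℝ → ℂ}

/-- A single component `α(x) e^{2π i ν φ(x)}`. -/
noncomputable def component (α φ : ℝ → ℝ) (ν x : ℝ) : ℂ :=
  (α x : ℂ) * Complex.exp (2 * Real.pi * Complex.I * (ν * φ x : ℝ))

lemma superposition_eq_sum {K : ℕ} (α φ : Fin K → ℝ → ℝ) (ν : Fin K → ℝ) (x : ℝ) :
    superposition α φ ν x = ∑ k, component (α k) (φ k) (ν k) x := rfl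

lemma IsModeType.differentiable_amp (hα : IsModeType M α φ) : Differentiable ℝ α :=
  hα.smooth_amp.differentiable (by simp)

lemma IsModeType.differentiable_phase (hα : IsModeType M α φ) : Differentiable ℝ φ :=
  hα.smooth_phase.differentiable (by simp)

lemma IsModeType.contDiff_deriv_phase (hα : IsModeType M α φ) : ContDiff ℝ 1 (deriv φ) := by
  have h2 : ContDiff ℝ 2 φ := contDiff_infty.1 hα.smooth_phase 2
  exact (contDiff_succ_iff_deriv (n := 1)).1 h2 |>.2.2

lemma IsModeType.continuous_deriv_amp (hα : IsModeType M α φ) : Continuous (deriv α) :=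
  hα.smooth_amp.continuous_deriv (by simp)

lemma IsModeType.abs_amp_le (hα : IsModeType M α φ) (hM : 0 < M) (x : ℝ) : |α x| ≤ M := by
  rw [abs_of_nonneg ((by positivity : (0 : ℝ) ≤ 1 / M).trans (hα.amp_ge x))]
  exact hα.amp_le x

/-- Follows from `1/M ≤ α(0) ≤ M`. -/
lemma IsModeType.one_le (hα : IsModeType M α φ) (hM : 0 < M) : 1 ≤ M := by
  have h := (hα.amp_ge 0).trans (hα.amp_le 0)
  rw [div_le_iff₀ hM] at h
  nlinarith

lemma IsModeType.abs_amp_sub_le (hα : IsModeType M α φ) (x y : ℝ) :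
    |α y - α x| ≤ M * |y - x| :=
  convex_univ.norm_image_sub_le_of_norm_deriv_le (fun z _ => hα.differentiable_amp z)
    (fun z _ => hα.deriv_amp_le z) (mem_univ x) (mem_univ y)

lemma IsModeType.abs_phase_sub_le (hα : IsModeType M α φ) (hM : 0 < M) (x t : ℝ) :
    |φ (x + t) - φ x - deriv φ x * t| ≤ M * t ^ 2 := by
  have hd : ∀ z, HasDerivAt (fun y => φ y - deriv φ x * y) (deriv φ z - deriv φ x) z := fun z =>
    ((hα.differentiable_phase z).hasDerivAt.sub
      ((hasDerivAt_id z).const_mul (deriv φ x))).congr_deriv (by simp)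
  have hbd : ∀ z ∈ Metric.closedBall x |t|,
      ‖deriv (fun y => φ y - deriv φ x * y) z‖ ≤ M * |t| := by
    intro z hz
    rw [(hd z).deriv]
    have h1 := convex_univ.norm_image_sub_le_of_norm_deriv_le
      (fun z _ => hα.contDiff_deriv_phase.differentiable one_ne_zero z)
      (fun z _ => hα.deriv2_phase_le z) (mem_univ x) (mem_univ z)
    refine h1.trans (mul_le_mul_of_nonneg_left ?_ hM.le)
    simpa [Real.dist_eq] using hz
  have := (convex_closedBall x |t|).norm_image_sub_le_of_norm_deriv_le
    (fun z _ => (hd z).differentiableAt) hbd (Metric.mem_closedBall_self (abs_nonneg t))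
    (show x + t ∈ Metric.closedBall x |t| by simp)
  rw [Real.norm_eq_abs, Real.norm_eq_abs, add_sub_cancel_left, mul_assoc, ← sq, sq_abs] at this
  convert this using 2
  ring

lemma norm_exp_sub_exp_le (x y : ℝ) :
    ‖Complex.exp (2 * Real.pi * Complex.I * (x : ℝ)) -
      Complex.exp (2 * Real.pi * Complex.I * (y : ℝ))‖ ≤ 2 * Real.pi * |x - y| := by
  have h1 : Complex.exp (2 * Real.pi * Complex.I * (x : ℝ)) -
      Complex.exp (2 * Real.pi * Complex.I * (y : ℝ)) =
      Complex.exp (2 * Real.pi * Complex.I * (y : ℝ)) *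
        (Complex.exp (Complex.I * ((2 * Real.pi * (x - y) : ℝ) : ℂ)) - 1) := by
    rw [mul_sub, ← Complex.exp_add, mul_one]
    congr 2
    push_cast
    ring
  rw [h1, norm_mul, norm_exp_two_pi_I, one_mul]
  refine Real.norm_exp_I_mul_ofReal_sub_one_le.trans ?_
  rw [Real.norm_eq_abs, abs_mul, abs_of_pos (by positivity)]

lemma norm_component (hα : IsModeType M α φ) (hM : 0 < M) (x : ℝ) :
    ‖component α φ ν x‖ ≤ M := by
  rw [component, norm_mul, norm_exp_two_pi_I, mul_one, Complex.norm_real]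
  exact hα.abs_amp_le hM x

lemma hasDerivAt_component (hα : IsModeType M α φ) (x : ℝ) :
    HasDerivAt (component α φ ν) (((deriv α x : ℝ) : ℂ) * Complex.exp (2 * Real.pi * Complex.I *
      (ν * φ x : ℝ)) + α x * (Complex.exp (2 * Real.pi * Complex.I * (ν * φ x : ℝ)) *
        (2 * Real.pi * Complex.I * (ν * deriv φ x : ℝ)))) x :=
  (hα.differentiable_amp x).hasDerivAt.ofReal_comp.mul
    (((hα.differentiable_phase x).hasDerivAt.const_mul ν).ofReal_comp.const_mul
      (2 * Real.pi * Complex.I)).cexp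

/-- The rescaled oscillatory integral that computes a wave packet coefficient. -/
noncomputable def rescaledTransform (w : ℝ → ℂ) (f : ℝ → ℂ) (h a b : ℝ) : ℂ :=
  ∫ y, f (b + h * y) * (starRingEnd ℂ) (w y) *
    Complex.exp (2 * Real.pi * Complex.I * (-(h * y * a) : ℝ))

/-- Substitution of `x = b + |a|^{-s} y`. The surviving prefactor `|a|^{-s/2}` is the weight in the
definition of `R_δ`. -/
lemma transform_eq_rescaled (f : ℝ → ℂ) (ha : a ≠ 0) :
    transform w s f a b =
      ((|a| ^ (s / 2))⁻¹ : ℝ) * rescaledTransform w f (|a| ^ s)⁻¹ a b := by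
  have hl := Real.rpow_pos_of_pos (abs_pos.2 ha) s
  have hl2 := Real.rpow_pos_of_pos (abs_pos.2 ha) (s / 2)
  have h := integral_comp_rescale (fun y => f (b + (|a| ^ s)⁻¹ * y) * (starRingEnd ℂ) (w y) *
    Complex.exp (2 * Real.pi * Complex.I * (-((|a| ^ s)⁻¹ * y * a) : ℝ))) hl b
  rw [← rescaledTransform, ← smul_right_inj hl2.ne', smul_smul, ← integral_smul] at h
  have h3 : |a| ^ (s / 2) * (|a| ^ s)⁻¹ = (|a| ^ (s / 2))⁻¹ := by
    rw [← rpow_half_sq a s]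
    field_simp
  rw [h3, Complex.real_smul] at h
  rw [← h, transform]
  congr 1 with x
  have hx : (|a| ^ s)⁻¹ * (|a| ^ s * (x - b)) = x - b := by field_simp
  rw [hx, packet, add_sub_cancel, map_mul, map_mul, Complex.conj_ofReal, ← Complex.exp_conj,
    Complex.real_smul]
  simp only [map_mul, Complex.conj_I, Complex.conj_ofReal, map_ofNat]
  push_cast
  ring_nf

lemma integrable_rescaled {f : ℝ → ℂ} (hf : Continuous f) {F : ℝ} (hF : ∀ x, ‖f x‖ ≤ F)
    (hc : Continuous w) (hw : Integrable w) :
    Integrable fun y => f (b + h * y) * (starRingEnd ℂ) (w y) *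
      Complex.exp (2 * Real.pi * Complex.I * (-(h * y * a) : ℝ)) := by
  refine (hw.norm.const_mul F).mono' ?_ (ae_of_all _ fun y => ?_)
  · have := Complex.continuous_conj
    exact Continuous.aestronglyMeasurable (by fun_prop)
  · rw [norm_mul, norm_mul, norm_exp_two_pi_I, mul_one, RCLike.norm_conj]
    exact mul_le_mul_of_nonneg_right (hF _) (norm_nonneg _)

lemma continuous_component (hα : IsModeType M α φ) : Continuous (component α φ ν) :=
  continuous_iff_continuousAt.2 fun x => (hasDerivAt_component hα x).continuousAt

/-- Freezing the amplitude at `b` and replacing the phase by its tangent line turns the integral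
into a unimodular multiple of `α(b)` times the conjugate of a value of `ŵ`. The amplitude error is
linear and the phase error quadratic in `h y`, which is why the moments `∫ |y| |w|` and `∫ y² |w|`
are needed. -/
lemma norm_rescaled_le_of_frozen (hα : IsModeType M α φ) (hM : 0 < M) (hν : 0 < ν) (hh : 0 < h)
    (hw : IsMotherPacket ε m w) (hB : PacketSize B w) :
    ‖rescaledTransform w (component α φ ν) h a b‖ ≤
      M * ‖𝓕 w (h * (ν * deriv φ b - a))‖ + h * M * B + 2 * Real.pi * M ^ 2 * ν * h ^ 2 * B := by
  set A : ℂ := (α b : ℂ) * Complex.exp (2 * Real.pi * Complex.I * (ν * φ b : ℝ)) with hA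
  set ξ := h * (ν * deriv φ b - a) with hξ
  have hmain : (∫ y, A * (starRingEnd ℂ)
      (Complex.exp (((-2 * Real.pi * y * ξ : ℝ) : ℂ) * Complex.I) • w y)) =
      A * (starRingEnd ℂ) (𝓕 w ξ) := by
    rw [Real.fourier_real_eq_integral_exp_smul, ← integral_conj, ← integral_const_mul]
  have hiA : Integrable fun y => A * (starRingEnd ℂ)
      (Complex.exp (((-2 * Real.pi * y * ξ : ℝ) : ℂ) * Complex.I) • w y) := by
    refine (hw.integrable.norm.const_mul ‖A‖).mono' ?_ (ae_of_all _ fun y => ?_)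
    · have := Complex.continuous_conj
      have := hw.continuous
      exact Continuous.aestronglyMeasurable (by fun_prop)
    · rw [norm_mul, RCLike.norm_conj, norm_smul, Complex.norm_exp_ofReal_mul_I, one_mul]
  have hAn : ‖A‖ ≤ M := norm_component (ν := ν) hα hM b
  have hiI := integrable_rescaled (h := h) (a := a) (b := b) (continuous_component (ν := ν) hα)
    (norm_component hα hM) hw.continuous hw.integrable
  have hdiff : ‖rescaledTransform w (component α φ ν) h a b - A * (starRingEnd ℂ) (𝓕 w ξ)‖ ≤
      h * M * B + 2 * Real.pi * M ^ 2 * ν * h ^ 2 * B := by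
    rw [← hmain, rescaledTransform, ← integral_sub hiI hiA]
    have i1 := (hB.integrable_abs_mul hw.integrable).const_mul (h * M)
    have i2 := (hB.integrable_sq_mul hw.integrable).const_mul (2 * Real.pi * M ^ 2 * ν * h ^ 2)
    refine (norm_integral_le_of_norm_le (i1.fun_add i2) (ae_of_all _ fun y => ?_)).trans ?_
    · have e1 : component α φ ν (b + h * y) * (starRingEnd ℂ) (w y) *
          Complex.exp (2 * Real.pi * Complex.I * (-(h * y * a) : ℝ)) -
          A * (starRingEnd ℂ) (Complex.exp (((-2 * Real.pi * y * ξ : ℝ) : ℂ) * Complex.I) • w y) =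
          (((α (b + h * y) - α b : ℝ) : ℂ) *
              Complex.exp (2 * Real.pi * Complex.I * (ν * φ (b + h * y) : ℝ)) +
            α b * (Complex.exp (2 * Real.pi * Complex.I * (ν * φ (b + h * y) : ℝ)) -
              Complex.exp (2 * Real.pi * Complex.I * (ν * (φ b + deriv φ b * (h * y)) : ℝ)))) *
          ((starRingEnd ℂ) (w y) *
            Complex.exp (2 * Real.pi * Complex.I * (-(h * y * a) : ℝ))) := by
        have e2 : (starRingEnd ℂ) (Complex.exp (((-2 * Real.pi * y * ξ : ℝ) : ℂ) * Complex.I)) =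
            Complex.exp (2 * Real.pi * Complex.I * (ν * (deriv φ b * (h * y)) : ℝ)) *
              Complex.exp (2 * Real.pi * Complex.I * (-(h * y * a) : ℝ)) := by
          rw [← Complex.exp_conj, ← Complex.exp_add, map_mul, Complex.conj_ofReal, Complex.conj_I,
            hξ]
          congr 1
          push_cast
          ring
        have e3 : Complex.exp (2 * Real.pi * Complex.I *
            (ν * (φ b + deriv φ b * (h * y)) : ℝ)) =
            Complex.exp (2 * Real.pi * Complex.I * (ν * φ b : ℝ)) *
            Complex.exp (2 * Real.pi * Complex.I * (ν * (deriv φ b * (h * y)) : ℝ)) := by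
          rw [← Complex.exp_add]
          congr 1
          push_cast
          ring
        rw [smul_eq_mul, map_mul, e2, e3, hA, component]
        push_cast
        ring
      rw [e1, norm_mul, norm_mul, norm_exp_two_pi_I, mul_one, RCLike.norm_conj,
        show h * M * (|y| * ‖w y‖) + 2 * Real.pi * M ^ 2 * ν * h ^ 2 * (y ^ 2 * ‖w y‖) =
          (h * M * |y| + 2 * Real.pi * M ^ 2 * ν * h ^ 2 * y ^ 2) * ‖w y‖ by ring]
      refine mul_le_mul_of_nonneg_right ?_ (norm_nonneg _)
      refine (norm_add_le _ _).trans (add_le_add ?_ ?_)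
      · rw [norm_mul, norm_exp_two_pi_I, mul_one, Complex.norm_real, Real.norm_eq_abs]
        refine (hα.abs_amp_sub_le _ _).trans (le_of_eq ?_)
        rw [add_sub_cancel_left, abs_mul, abs_of_pos hh]
        ring
      · rw [norm_mul, Complex.norm_real, Real.norm_eq_abs]
        have h1 := norm_exp_sub_exp_le (ν * φ (b + h * y)) (ν * (φ b + deriv φ b * (h * y)))
        have h2 := hα.abs_phase_sub_le hM b (h * y)
        rw [show ν * φ (b + h * y) - ν * (φ b + deriv φ b * (h * y)) =
          ν * (φ (b + h * y) - φ b - deriv φ b * (h * y)) by ring, abs_mul, abs_of_pos hν] at h1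
        calc _ ≤ M * (2 * Real.pi * (ν * (M * (h * y) ^ 2))) := by
              gcongr
              · exact hα.abs_amp_le hM b
              · exact h1.trans (by gcongr)
          _ = _ := by ring
    · have i1' := hB.integral_abs_mul_le hw.integrable
      have i2' := hB.integral_sq_mul_le hw.integrable
      rw [integral_add i1 i2, integral_const_mul, integral_const_mul]
      gcongr
  calc ‖rescaledTransform w (component α φ ν) h a b‖
      ≤ ‖A * (starRingEnd ℂ) (𝓕 w ξ)‖ +
        ‖rescaledTransform w (component α φ ν) h a b - A * (starRingEnd ℂ) (𝓕 w ξ)‖ := by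
        have := norm_add_le (A * (starRingEnd ℂ) (𝓕 w ξ))
          (rescaledTransform w (component α φ ν) h a b - A * (starRingEnd ℂ) (𝓕 w ξ))
        rwa [add_sub_cancel] at this
    _ ≤ M * ‖𝓕 w ξ‖ + (h * M * B + 2 * Real.pi * M ^ 2 * ν * h ^ 2 * B) := by
        rw [norm_mul, RCLike.norm_conj]
        gcongr
    _ = _ := by ring

/-- Integration by parts when the frequency of the component dominates that of the packet. -/
lemma norm_rescaled_le_of_nonstationary (hα : IsModeType M α φ) (hM : 0 < M) (hν : 0 < ν)
    (hh : 0 < h) (hm : 3 ≤ m) (hw : IsMotherPacket ε m w) (hB : PacketSize B w)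
    (ha : |a| ≤ ν / (2 * M)) :
    ‖rescaledTransform w (component α φ ν) h a b‖ ≤
      (h * M * B + M * B) / (h * ν / (2 * M)) +
        M * (h ^ 2 * ν * M) * B / (h * ν / (2 * M)) ^ 2 := by
  have hB0 := hB.pos hw
  -- `κ` bounds the rescaled frequency `θ'` from below: `|ν φ'| ≥ ν/M`, of which `|a|` takes away at
  -- most half.
  set κ := h * ν / (2 * M) with hκ
  have hκ0 : 0 < κ := by positivity
  set θ' : ℝ → ℝ := fun y => h * (ν * deriv φ (b + h * y) - a) with hθ'
  have hlow : ∀ y, κ ≤ |θ' y| := by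
    intro y
    have h1 := hα.deriv_phase_ge (b + h * y)
    have h2 : ν / M ≤ |ν * deriv φ (b + h * y)| := by
      rw [abs_mul, abs_of_pos hν]
      calc ν / M = ν * (1 / M) := by ring
        _ ≤ _ := by gcongr
    have h3 := abs_sub_abs_le_abs_sub (ν * deriv φ (b + h * y)) a
    have h4 : ν / (2 * M) ≤ |ν * deriv φ (b + h * y) - a| := by
      have : ν / M = ν / (2 * M) + ν / (2 * M) := by field_simp; ring
      linarith
    rw [hθ', abs_mul, abs_of_pos hh, hκ, mul_div_assoc]
    gcongr
  have hne : ∀ y, θ' y ≠ 0 := fun y hy => by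
    have := hlow y
    rw [hy, abs_zero] at this
    linarith
  have hlin : ∀ y : ℝ, HasDerivAt (fun y => b + h * y) h y := fun y => by
    simpa using ((hasDerivAt_id y).const_mul h).const_add b
  have hdθ : ∀ y, HasDerivAt θ' (h * (ν * (deriv (deriv φ) (b + h * y) * h))) y := fun y =>
    ((((hα.contDiff_deriv_phase.differentiable one_ne_zero _).hasDerivAt.comp y (hlin y)).const_mul
      ν).sub_const a).const_mul h
  set g : ℝ → ℂ := fun y => (α (b + h * y) : ℂ) * (starRingEnd ℂ) (w y) with hg
  set g' : ℝ → ℂ := fun y => ((deriv α (b + h * y) * h : ℝ) : ℂ) * (starRingEnd ℂ) (w y) +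
    (α (b + h * y) : ℂ) * (starRingEnd ℂ) (deriv w y) with hg'
  have hdg : ∀ y, HasDerivAt g (g' y) y := fun y =>
    (((hα.differentiable_amp _).hasDerivAt.comp y (hlin y)).ofReal_comp).mul
      ((hw.differentiable hm y).hasDerivAt.star)
  set E : ℝ → ℂ := fun y => Complex.exp (2 * Real.pi * Complex.I *
    ((ν * φ (b + h * y) - h * y * a : ℝ) : ℂ)) with hE
  have hdE : ∀ y, HasDerivAt E (E y * (2 * Real.pi * Complex.I * (θ' y : ℝ))) y := by
    intro y
    have h1 : HasDerivAt (fun y => ν * φ (b + h * y) - h * y * a) (θ' y) y := by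
      have h2 := ((hα.differentiable_phase _).hasDerivAt.comp y (hlin y)).const_mul ν
      have h3 := (((hasDerivAt_id y).const_mul h).mul_const a)
      refine (h2.sub h3).congr_deriv ?_
      simp only [hθ']
      ring
    exact (h1.ofReal_comp.const_mul (2 * Real.pi * Complex.I)).cexp
  set c : ℂ := 2 * Real.pi * Complex.I with hc
  have hcn : ‖c‖ = 2 * Real.pi := by simp [hc, abs_of_pos Real.pi_pos]
  have hc0 : c ≠ 0 := by rw [← norm_ne_zero_iff, hcn]; positivity
  have hc1 : 1 ≤ ‖c‖ := by rw [hcn]; linarith [Real.pi_gt_three]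
  -- Since `E' = c θ' E`, the integrand `g E` equals `q E'`, and integration by parts moves the
  -- derivative to `q`. The gain `1 / |c| ≤ 1` is discarded below.
  set q : ℝ → ℂ := fun y => g y / (c * (θ' y : ℝ)) with hq
  set q' : ℝ → ℂ := fun y => (g' y * (c * (θ' y : ℝ)) - g y * (c * ((h * (ν * (deriv (deriv φ)
    (b + h * y) * h)) : ℝ) : ℂ))) / (c * (θ' y : ℝ)) ^ 2 with hq'
  have hden : ∀ y, c * (θ' y : ℝ) ≠ 0 := fun y =>
    mul_ne_zero hc0 (by exact_mod_cast hne y)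
  have hdq : ∀ y, HasDerivAt q (q' y) y := fun y =>
    (hdg y).div ((hdθ y).ofReal_comp.const_mul c) (hden y)
  have hEn : ∀ y, ‖E y‖ = 1 := fun y => norm_exp_two_pi_I _
  have hgn : ∀ y, ‖g y‖ ≤ M * ‖w y‖ := fun y => by
    rw [hg, norm_mul, RCLike.norm_conj, Complex.norm_real]
    exact mul_le_mul_of_nonneg_right (hα.abs_amp_le hM _) (norm_nonneg _)
  have hgn' : ∀ y, ‖g' y‖ ≤ h * M * ‖w y‖ + M * ‖deriv w y‖ := fun y => by
    refine (norm_add_le _ _).trans (add_le_add ?_ ?_)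
    · rw [norm_mul, RCLike.norm_conj, Complex.norm_real, Real.norm_eq_abs, abs_mul, abs_of_pos hh,
        mul_comm h M]
      gcongr
      exact hα.deriv_amp_le _
    · rw [norm_mul, RCLike.norm_conj, Complex.norm_real]
      exact mul_le_mul_of_nonneg_right (hα.abs_amp_le hM _) (norm_nonneg _)
  have hqn' : ∀ y, ‖q' y‖ ≤ (h * M * ‖w y‖ + M * ‖deriv w y‖) / κ +
      M * ‖w y‖ * (h ^ 2 * ν * M) / κ ^ 2 := by
    intro y
    have e1 : q' y = c⁻¹ * (g' y / (θ' y : ℝ) - g y * ((h * (ν * (deriv (deriv φ)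
        (b + h * y) * h)) : ℝ) : ℂ) / (θ' y : ℝ) ^ 2) := by
      have h1 : ((θ' y : ℝ) : ℂ) ≠ 0 := by exact_mod_cast hne y
      simp only [hq']
      field_simp
    have h5 : |h * (ν * (deriv (deriv φ) (b + h * y) * h))| ≤ h ^ 2 * ν * M := by
      rw [abs_mul, abs_mul, abs_mul, abs_of_pos hh, abs_of_pos hν]
      calc h * (ν * (|deriv (deriv φ) (b + h * y)| * h)) ≤ h * (ν * (M * h)) := by
            gcongr
            exact hα.deriv2_phase_le _
        _ = _ := by ring
    rw [e1, norm_mul, norm_inv]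
    have h6 : ‖c‖⁻¹ ≤ 1 := inv_le_one_of_one_le₀ hc1
    refine (mul_le_of_le_one_left (norm_nonneg _) h6).trans ?_
    refine (norm_sub_le _ _).trans (add_le_add ?_ ?_)
    · rw [norm_div, Complex.norm_real, Real.norm_eq_abs]
      have := hlow y
      gcongr
      exact hgn' y
    · rw [norm_div, norm_mul, norm_pow, Complex.norm_real, Complex.norm_real, Real.norm_eq_abs,
        Real.norm_eq_abs]
      have := hlow y
      gcongr
      exact hgn y
  have hcd : Continuous (deriv w) := hw.continuous_deriv hm
  have hcw := hw.continuous
  have hcon := Complex.continuous_conj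
  have hcg : Continuous g := continuous_iff_continuousAt.2 fun y => (hdg y).continuousAt
  have hcE : Continuous E := continuous_iff_continuousAt.2 fun y => (hdE y).continuousAt
  have hcθ : Continuous θ' := continuous_iff_continuousAt.2 fun y => (hdθ y).continuousAt
  have hcq : Continuous q := continuous_iff_continuousAt.2 fun y => (hdq y).continuousAt
  have hcα : Continuous α := hα.smooth_amp.continuous
  have hcα' := hα.continuous_deriv_amp
  have hcφ'' : Continuous (deriv (deriv φ)) := hα.contDiff_deriv_phase.continuous_deriv le_rfl
  have hcq' : Continuous q' := by
    refine Continuous.div ?_ (by fun_prop) fun y => pow_ne_zero 2 (hden y)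
    have : Continuous g' := by fun_prop
    fun_prop
  have j1 : Integrable fun y => (h * M * ‖w y‖ + M * ‖deriv w y‖) / κ :=
    ((hw.integrable.norm.const_mul (h * M)).add (hB.integrable_deriv.norm.const_mul M)).div_const κ
  have j2 : Integrable fun y => M * ‖w y‖ * (h ^ 2 * ν * M) / κ ^ 2 :=
    ((hw.integrable.norm.const_mul M).mul_const _).div_const _
  have iq' : Integrable q' := (j1.add j2).mono' hcq'.aestronglyMeasurable (ae_of_all _ hqn')
  have hgi : Integrable g :=
    (hw.integrable.norm.const_mul M).mono' hcg.aestronglyMeasurable (ae_of_all _ hgn)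
  have i1 : Integrable (q * fun y => E y * (c * (θ' y : ℝ))) := by
    refine hgi.norm.mono' ?_ (ae_of_all _ fun y => ?_)
    · exact Continuous.aestronglyMeasurable (by fun_prop)
    · have : (q * fun y => E y * (c * (θ' y : ℝ))) y = g y * E y := by
        simp only [Pi.mul_apply, hq]
        rw [mul_comm (E y), ← mul_assoc, div_mul_cancel₀ _ (hden y)]
      rw [this, norm_mul, hEn, mul_one]
  have i2 : Integrable (q' * E) := by
    refine iq'.norm.mono' (hcq'.mul hcE).aestronglyMeasurable (ae_of_all _ fun y => ?_)
    rw [Pi.mul_apply, norm_mul, hEn, mul_one]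
  have i3 : Integrable (q * E) := by
    refine ((hw.integrable.norm.const_mul M).div_const κ).mono' (hcq.mul hcE).aestronglyMeasurable (ae_of_all _ fun y => ?_)
    rw [Pi.mul_apply, norm_mul, hEn, mul_one, hq, norm_div]
    have : κ ≤ ‖c * (θ' y : ℝ)‖ := by
      rw [norm_mul, Complex.norm_real]
      exact (hlow y).trans (le_mul_of_one_le_left (abs_nonneg _) hc1)
    gcongr
    exact hgn y
  have hibp := integral_mul_deriv_eq_deriv_mul_of_integrable (fun y _ => hdq y) (fun y _ => hdE y)
    i1 i2 i3
  have hI : rescaledTransform w (component α φ ν) h a b = ∫ y, q y * (E y * (c * (θ' y : ℝ))) := by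
    rw [rescaledTransform]
    congr 1 with y
    have e1 : E y = Complex.exp (2 * Real.pi * Complex.I * (ν * φ (b + h * y) : ℝ)) *
        Complex.exp (2 * Real.pi * Complex.I * (-(h * y * a) : ℝ)) := by
      simp only [hE]
      rw [← Complex.exp_add, ← hc]
      congr 1
      push_cast
      ring
    have e2 : q y * (E y * (c * (θ' y : ℝ))) = g y * E y := by
      rw [hq, mul_comm (E y), ← mul_assoc, div_mul_cancel₀ _ (hden y)]
    rw [e2, e1, component, hg]
    ring
  rw [hI, hibp, norm_neg]
  refine (norm_integral_le_of_norm_le (j1.fun_add j2) (ae_of_all _ fun y => ?_)).trans ?_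
  · rw [norm_mul, hEn, mul_one]
    exact hqn' y
  · rw [integral_add j1 j2, integral_div, integral_div, integral_add (hw.integrable.norm.const_mul (h * M))
      (hB.integrable_deriv.norm.const_mul M), integral_const_mul, integral_const_mul,
      integral_mul_const, integral_const_mul]
    have k1 := hB.integral_norm_le hw.integrable
    have k2 := hB.deriv_le
    rw [show M * (h ^ 2 * ν * M) * B = M * B * (h ^ 2 * ν * M) by ring]
    gcongr

end Component

/-! ### Smallness of a component outside its band -/

section OutsideBand

variable {M ν s a b : ℝ} {α φ : ℝ → ℝ} {ε B : ℝ} {m : ℕ} {w : ℝ → ℂ}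

/-- A component is nearly invisible to wave packets outside of its frequency band. -/
lemma norm_rescaled_component_le (hα : IsModeType M α φ) (hM : 1 ≤ M) (hν : 1 ≤ ν)
    (hs0 : 1 / 2 < s) (hs1 : s < 1) (hm : 3 ≤ m) (hw : IsMotherPacket ε m w) (hε : 0 < ε)
    (hB : PacketSize B w) (ha : a ≠ 0) (hZ : (a, b) ∉ Zset s ν φ) :
    ‖rescaledTransform w (component α φ ν) (|a| ^ s)⁻¹ a b‖ ≤
      M * (ε / 2 ^ m) + 28 * M ^ 4 * B * (ν ^ (1 - 2 * s) + ν ^ (s - 1)) := by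
  have hB0 := hB.pos hw
  have hM0 : 0 < M := by linarith
  have hν0 : 0 < ν := by linarith
  have ha0 := abs_pos.2 ha
  have hl := Real.rpow_pos_of_pos ha0 s
  have hνs := Real.rpow_pos_of_pos hν0 s
  have hr1 : 0 < ν ^ (1 - 2 * s) := Real.rpow_pos_of_pos hν0 _
  have hr2 : 0 < ν ^ (s - 1) := Real.rpow_pos_of_pos hν0 _
  have hp1 : M ≤ M ^ 4 := le_self_pow₀ hM (by norm_num)
  have hp2 : M ^ 2 ≤ M ^ 4 := pow_le_pow_right₀ hM (by norm_num)
  -- For `|a| ≥ ν/(2M)` the packet is narrow, `|a|^{-s} ≤ 2M ν^{-s}`, and the frozen estimate is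
  -- good. For smaller `|a|` the packet may be wide, but its frequency stays away from that of the
  -- component.
  rcases le_or_gt (ν / (2 * M)) |a| with hc | hc
  · refine (norm_rescaled_le_of_frozen hα hM0 hν0 (inv_pos.2 hl) hw hB).trans ?_
    have hZ' : |a| ^ s < |a - ν * deriv φ b| := not_le.1 hZ
    have hξ : 1 < |(|a| ^ s)⁻¹ * (ν * deriv φ b - a)| := by
      rw [abs_mul, abs_of_pos (inv_pos.2 hl), abs_sub_comm, inv_mul_eq_div, one_lt_div hl]
      exact hZ'
    have h1 : ‖𝓕 w ((|a| ^ s)⁻¹ * (ν * deriv φ b - a))‖ ≤ ε / 2 ^ m := by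
      refine (hw.fourier_decay _ hξ).trans ?_
      gcongr
      linarith
    have h2 : (|a| ^ s)⁻¹ ≤ 2 * M * ν ^ (-s) := by
      rw [Real.rpow_neg hν0.le, ← div_eq_mul_inv, inv_le_comm₀ hl (by positivity), inv_div]
      calc ν ^ s / (2 * M) ≤ ν ^ s / (2 * M) ^ s := by
            gcongr
            exact Real.rpow_le_self_of_one_le (by linarith) hs1.le
        _ = (ν / (2 * M)) ^ s := (Real.div_rpow hν0.le (by positivity) s).symm
        _ ≤ |a| ^ s := Real.rpow_le_rpow (by positivity) hc (by linarith)
    have h3 : ν ^ (-s) ≤ ν ^ (1 - 2 * s) :=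
      Real.rpow_le_rpow_of_exponent_le hν (by linarith)
    have h4 : ν * (ν ^ (-s)) ^ 2 = ν ^ (1 - 2 * s) := by
      rw [← Real.rpow_natCast, ← Real.rpow_mul hν0.le]
      nth_rewrite 1 [← Real.rpow_one ν]
      rw [← Real.rpow_add hν0]
      congr 1
      push_cast
      ring
    have h5 : (|a| ^ s)⁻¹ * M * B ≤ 2 * M ^ 4 * B * ν ^ (1 - 2 * s) := by
      calc (|a| ^ s)⁻¹ * M * B ≤ (2 * M * ν ^ (1 - 2 * s)) * M * B := by
            gcongr
            exact h2.trans (by gcongr)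
        _ = 2 * M ^ 2 * B * ν ^ (1 - 2 * s) := by ring
        _ ≤ _ := by gcongr
    have h6 : 2 * Real.pi * M ^ 2 * ν * ((|a| ^ s)⁻¹) ^ 2 * B ≤
        26 * M ^ 4 * B * ν ^ (1 - 2 * s) := by
      calc 2 * Real.pi * M ^ 2 * ν * ((|a| ^ s)⁻¹) ^ 2 * B
          ≤ 2 * 3.15 * M ^ 2 * ν * (2 * M * ν ^ (-s)) ^ 2 * B := by
            gcongr
            exact Real.pi_lt_d2.le
        _ = 25.2 * M ^ 4 * B * (ν * (ν ^ (-s)) ^ 2) := by ring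
        _ ≤ 26 * M ^ 4 * B * ν ^ (1 - 2 * s) := by
            rw [h4]
            gcongr
            norm_num
    have h7 : M * ‖𝓕 w ((|a| ^ s)⁻¹ * (ν * deriv φ b - a))‖ ≤ M * (ε / 2 ^ m) := by gcongr
    have h8 : 0 ≤ 28 * M ^ 4 * B * ν ^ (s - 1) := by positivity
    linarith
  · refine (norm_rescaled_le_of_nonstationary hα hM0 hν0 (inv_pos.2 hl) hm hw hB hc.le).trans ?_
    have haν : |a| ≤ ν := hc.le.trans (div_le_self hν0.le (by linarith))
    have h1 : |a| ^ s ≤ ν ^ s := Real.rpow_le_rpow ha0.le haν (by linarith)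
    have h2 : ν ^ s / ν = ν ^ (s - 1) := by rw [Real.rpow_sub_one hν0.ne']
    have h3 : ν⁻¹ ≤ ν ^ (s - 1) := by
      rw [← Real.rpow_neg_one]
      exact Real.rpow_le_rpow_of_exponent_le hν (by linarith)
    -- The scale `|a|^{-s}` cancels in the terms from `α'` and `φ''`, which are `O(1/ν)`. The
    -- dominant term `|a|^s / ν` comes from `w'`.
    have e1 : ((|a| ^ s)⁻¹ * M * B + M * B) / ((|a| ^ s)⁻¹ * ν / (2 * M)) +
        M * (((|a| ^ s)⁻¹) ^ 2 * ν * M) * B / ((|a| ^ s)⁻¹ * ν / (2 * M)) ^ 2 =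
        2 * M ^ 2 * B * ν⁻¹ + 2 * M ^ 2 * B * (|a| ^ s / ν) + 4 * M ^ 4 * B * ν⁻¹ := by
      field_simp
      ring
    rw [e1]
    have h4 : |a| ^ s / ν ≤ ν ^ (s - 1) := by rw [← h2]; gcongr
    calc 2 * M ^ 2 * B * ν⁻¹ + 2 * M ^ 2 * B * (|a| ^ s / ν) + 4 * M ^ 4 * B * ν⁻¹
        ≤ 2 * M ^ 4 * B * ν ^ (s - 1) + 2 * M ^ 4 * B * ν ^ (s - 1) +
          4 * M ^ 4 * B * ν ^ (s - 1) := by gcongr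
      _ = 8 * M ^ 4 * B * ν ^ (s - 1) := by ring
      _ ≤ 28 * M ^ 4 * B * ν ^ (s - 1) := by gcongr; norm_num
      _ ≤ M * (ε / 2 ^ m) + 28 * M ^ 4 * B * (ν ^ (1 - 2 * s) + ν ^ (s - 1)) := by
        have : 0 ≤ M * (ε / 2 ^ m) := by positivity
        have : 0 ≤ 28 * M ^ 4 * B * ν ^ (1 - 2 * s) := by positivity
        linarith

end OutsideBand

/-! ### Superpositions: smallness off the bands and the derivative in `b` -/

section Superposition

variable {M N s a b ε B : ℝ} {m K : ℕ} {w : ℝ → ℂ} {α φ : Fin K → ℝ → ℝ} {ν : Fin K → ℝ}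

lemma norm_superposition_le (hα : ∀ k, IsModeType M (α k) (φ k)) (hM : 0 < M) (x : ℝ) :
    ‖superposition α φ ν x‖ ≤ K * M := by
  rw [superposition_eq_sum]
  refine (norm_sum_le _ _).trans ?_
  have := Finset.sum_le_card_nsmul Finset.univ (fun k => ‖component (α k) (φ k) (ν k) x‖) M
    fun k _ => norm_component (hα k) hM x
  simpa using this

lemma rescaledTransform_superposition (hα : ∀ k, IsModeType M (α k) (φ k)) (hM : 0 < M)
    (hc : Continuous w) (hw : Integrable w) (h : ℝ) :
    rescaledTransform w (superposition α φ ν) h a b =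
      ∑ k, rescaledTransform w (component (α k) (φ k) (ν k)) h a b := by
  simp only [rescaledTransform]
  rw [← integral_finsetSum _ fun k _ => integrable_rescaled (continuous_component (hα k))
    (norm_component (hα k) hM) hc hw]
  congr 1 with y
  rw [superposition_eq_sum, Finset.sum_mul, Finset.sum_mul]

/-- The wave packet transform of a superposition is small away from all frequency bands. -/
lemma norm_transform_le_of_forall_notMem (hα : ∀ k, IsModeType M (α k) (φ k)) (hM : 1 ≤ M)
    (hν : ∀ k, 1 ≤ ν k) (hs0 : 1 / 2 < s) (hs1 : s < 1) (hm : 3 ≤ m)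
    (hw : IsMotherPacket ε m w) (hε0 : 0 < ε) (hε1 : ε < 1) (hB : PacketSize B w) (ha : a ≠ 0)
    (hlarge1 : ∀ k, 112 * (K + 1) * M ^ 4 * B * ν k ^ (1 - 2 * s) ≤ ε)
    (hlarge2 : ∀ k, 112 * (K + 1) * M ^ 4 * B * ν k ^ (s - 1) ≤ ε)
    (hK : 2 * M * K * √ε ≤ 2 ^ m) (hZ : ∀ k, (a, b) ∉ Zset s (ν k) (φ k)) :
    ‖transform w s (superposition α φ ν) a b‖ ≤ (|a| ^ (s / 2))⁻¹ * √ε := by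
  have hM0 : 0 < M := by linarith
  have hl2 := Real.rpow_pos_of_pos (abs_pos.2 ha) (s / 2)
  rw [transform_eq_rescaled _ ha, norm_mul, Complex.norm_real, Real.norm_of_nonneg (by positivity)]
  refine mul_le_mul_of_nonneg_left ?_ (by positivity)
  rw [rescaledTransform_superposition hα hM0 hw.continuous hw.integrable]
  refine (norm_sum_le _ _).trans ?_
  -- As `112 = 4 · 28`, each of the two errors of a component is at most `ε / (4(K+1))`.
  have hterm : ∀ k ∈ Finset.univ, ‖rescaledTransform w (component (α k) (φ k) (ν k))
      (|a| ^ s)⁻¹ a b‖ ≤ M * (ε / 2 ^ m) + ε / (2 * (K + 1)) := by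
    intro k _
    refine (norm_rescaled_component_le (hα k) hM (hν k) hs0 hs1 hm hw hε0 hB ha (hZ k)).trans ?_
    gcongr
    rw [le_div_iff₀ (by positivity)]
    linarith [hlarge1 k, hlarge2 k]
  refine (Finset.sum_le_card_nsmul _ _ _ hterm).trans ?_
  rw [Finset.card_univ, Fintype.card_fin, nsmul_eq_mul, mul_add]
  have hsq : √ε * √ε = ε := Real.mul_self_sqrt hε0.le
  have hs : 0 < √ε := Real.sqrt_pos.2 hε0
  have hle : ε ≤ √ε := by
    have : √ε ≤ 1 := Real.sqrt_le_one.2 hε1.le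
    nlinarith
  -- The budget `√ε` is split in halves: the values of `ŵ` use one through `hK`, the approximation
  -- errors use the other through `ε ≤ √ε`.
  have h1 : K * (M * (ε / 2 ^ m)) ≤ √ε / 2 := by
    have : K * (M * (ε / 2 ^ m)) = (2 * M * K * √ε) * √ε / 2 / 2 ^ m := by
      rw [mul_assoc _ √ε, hsq]; ring
    rw [this, div_le_iff₀ (by positivity)]
    nlinarith
  have h2 : K * (ε / (2 * (K + 1))) ≤ ε / 2 := by
    rw [mul_div_assoc', div_le_div_iff₀ (by positivity) (by positivity)]
    nlinarith
  linarith

lemma integral_norm_packet (g : ℝ → ℂ) (ha : a ≠ 0) :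
    ∫ x, ‖packet g s a b x‖ = (|a| ^ (s / 2))⁻¹ * ∫ x, ‖g x‖ := by
  have hl := Real.rpow_pos_of_pos (abs_pos.2 ha) s
  have hl2 := Real.rpow_pos_of_pos (abs_pos.2 ha) (s / 2)
  simp only [norm_packet]
  rw [integral_const_mul, integral_comp_rescale (fun y => ‖g y‖) hl b, smul_eq_mul, ← mul_assoc]
  congr 1
  rw [← rpow_half_sq a s]
  field_simp

lemma integrable_packet {g : ℝ → ℂ} (hc : Continuous g) (hg : Integrable g) (ha : a ≠ 0) :
    Integrable (packet g s a b) := by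
  have h := (integrable_comp_rescale hg.norm (Real.rpow_pos_of_pos (abs_pos.2 ha) s) b).const_mul
    (|a| ^ (s / 2))
  exact h.mono' (continuous_packet hc).aestronglyMeasurable
    (ae_of_all _ fun x => (norm_packet g s a b x).le)

lemma norm_integral_mul_conj_packet_le {f g : ℝ → ℂ} {F : ℝ} (hF : ∀ x, ‖f x‖ ≤ F)
    (hc : Continuous g) (hg : Integrable g) (ha : a ≠ 0) :
    ‖∫ x, f x * (starRingEnd ℂ) (packet g s a b x)‖ ≤
      F * ((|a| ^ (s / 2))⁻¹ * ∫ x, ‖g x‖) := by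
  rw [← integral_norm_packet (b := b) g ha, ← integral_const_mul]
  refine norm_integral_le_of_norm_le ((integrable_packet hc hg ha).norm.const_mul F)
    (ae_of_all _ fun x => ?_)
  rw [norm_mul, RCLike.norm_conj]
  exact mul_le_mul_of_nonneg_right (hF x) (norm_nonneg _)

lemma packet_add (g : ℝ → ℂ) (s a b y : ℝ) : packet g s a b (b + y) = packet g s a 0 y := by
  simp [packet]

/-- Moving `b` into the signal lets differentiation under the integral use the bounded derivative of
`f`, with the fixed integrable packet as dominating function up to a constant. -/
lemma transform_eq_shift (g f : ℝ → ℂ) (s a b : ℝ) :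
    transform g s f a b = ∫ y, f (b + y) * (starRingEnd ℂ) (packet g s a 0 y) := by
  rw [transform, ← integral_add_left_eq_self _ b]
  simp only [packet_add]

lemma hasDerivAt_packet {g : ℝ → ℂ} (hg : Differentiable ℝ g) (x : ℝ) :
    HasDerivAt (packet g s a b) ((2 * Real.pi * Complex.I * a) * packet g s a b x +
      ((|a| ^ s : ℝ) : ℂ) * packet (deriv g) s a b x) x := by
  have h := (hasDerivAt_packet_center (s := s) (a := a) (b := b) hg x)
  have h1 : packet g s a b = (fun b' => packet g s a b' x) ∘ fun x' => x + b - x' := by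
    ext x'
    simp only [packet, Function.comp]
    ring_nf
  rw [h1]
  have h2 : HasDerivAt (fun x' : ℝ => x + b - x') (-1) x := by
    simpa using (hasDerivAt_id x).const_sub (x + b)
  have h3 := HasDerivAt.scomp x (by simpa using h) h2
  refine h3.congr_deriv ?_
  simp only [neg_smul, one_smul, Function.comp, add_sub_cancel_left]
  ring

/-- `∂_b W_f` and `2π i a W_f` differ by a wave packet transform with respect to `w'`. -/
lemma deriv_transform (hw : Differentiable ℝ w) (hwi : Integrable w)
    (hcw' : Continuous (deriv w)) (hwi' : Integrable (deriv w)) {f f' : ℝ → ℂ}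
    (hf : ∀ x, HasDerivAt f (f' x) x) (hcf' : Continuous f') {F F' : ℝ} (hF : ∀ x, ‖f x‖ ≤ F)
    (hF' : ∀ x, ‖f' x‖ ≤ F') (ha : a ≠ 0) :
    deriv (fun b' => transform w s f a b') b = 2 * Real.pi * Complex.I * a * transform w s f a b -
      ((|a| ^ s : ℝ) : ℂ) * transform (deriv w) s f a b := by
  have hcf : Continuous f := continuous_iff_continuousAt.2 fun y => (hf y).continuousAt
  have hcon := Complex.continuous_conj
  have hcp : Continuous (packet w s a 0) := continuous_packet hw.continuous
  have hcp' : Continuous (packet (deriv w) s a 0) := continuous_packet hcw'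
  have hip := integrable_packet (s := s) (b := 0) hw.continuous hwi ha
  have hip' := integrable_packet (s := s) (b := 0) hcw' hwi' ha
  have hint : ∀ {u p : ℝ → ℂ} {U : ℝ}, Continuous u → (∀ x, ‖u x‖ ≤ U) → Continuous p →
      Integrable p → Integrable fun y => u (b + y) * (starRingEnd ℂ) (p y) := by
    intro u p U hu hU hp hpi
    refine (hpi.norm.const_mul U).mono' (Continuous.aestronglyMeasurable (by fun_prop))
      (ae_of_all _ fun y => ?_)
    rw [norm_mul, RCLike.norm_conj]
    exact mul_le_mul_of_nonneg_right (hU _) (norm_nonneg _)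
  have hshift : ∀ y, HasDerivAt (fun y => f (b + y)) (f' (b + y)) y := fun y => by
    simpa using (hf (b + y)).comp_const_add b y
  have hd := (hasDerivAt_integral_of_dominated_loc_of_deriv_le
    (F := fun b' y => f (b' + y) * (starRingEnd ℂ) (packet w s a 0 y))
    (F' := fun b' y => f' (b' + y) * (starRingEnd ℂ) (packet w s a 0 y))
    (x₀ := b) (s := univ) (bound := fun y => F' * ‖packet w s a 0 y‖) (μ := volume) univ_mem
    (Eventually.of_forall fun b' => Continuous.aestronglyMeasurable (by fun_prop))
    (hint hcf hF hcp hip) (Continuous.aestronglyMeasurable (by fun_prop))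
    (ae_of_all _ fun y b' _ => by
      rw [norm_mul, RCLike.norm_conj]
      exact mul_le_mul_of_nonneg_right (hF' _) (norm_nonneg _))
    (hip.norm.const_mul F')
    (ae_of_all _ fun y b' _ => by
      simpa using ((hf (b' + y)).comp_add_const b' y).mul_const
        ((starRingEnd ℂ) (packet w s a 0 y)))).2
  -- Integration by parts returns the derivative to the packet, where it produces the factor `2πi a`
  -- and a transform with respect to `w'`; the bound on `f'`, which grows with the frequencies,
  -- drops out.
  have hibp := integral_mul_deriv_eq_deriv_mul_of_integrable
    (u := fun y => f (b + y)) (u' := fun y => f' (b + y))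
    (v := fun y => (starRingEnd ℂ) (packet w s a 0 y))
    (v' := fun y => (starRingEnd ℂ) ((2 * Real.pi * Complex.I * a) * packet w s a 0 y +
      ((|a| ^ s : ℝ) : ℂ) * packet (deriv w) s a 0 y))
    (fun y _ => hshift y) (fun y _ => (hasDerivAt_packet hw y).star)
    (hint hcf hF (by fun_prop) ((hip.const_mul _).add (hip'.const_mul _)))
    (hint hcf' hF' hcp hip) (hint hcf hF hcp hip)
  have hfun : (fun b' => transform w s f a b') =
      fun b' => ∫ y, f (b' + y) * (starRingEnd ℂ) (packet w s a 0 y) := by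
    ext b'
    exact transform_eq_shift _ _ _ _ _
  rw [hfun, hd.deriv, ← neg_eq_iff_eq_neg.2 hibp, transform_eq_shift w, transform_eq_shift (deriv w),
    ← integral_const_mul, ← integral_const_mul, ← integral_sub, ← integral_neg]
  · congr 1 with y
    simp only [map_add, map_mul, Complex.conj_I, Complex.conj_ofReal, map_ofNat]
    ring
  · exact (hint hcf hF hcp hip).const_mul _
  · exact (hint hcf hF hcp' hip').const_mul _

lemma exists_deriv_superposition (hα : ∀ k, IsModeType M (α k) (φ k)) (hM : 0 < M) :
    ∃ f' : ℝ → ℂ, (∀ x, HasDerivAt (superposition α φ ν) (f' x) x) ∧ Continuous f' ∧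
      ∃ F' : ℝ, ∀ x, ‖f' x‖ ≤ F' := by
  refine ⟨fun x => ∑ k, (((deriv (α k) x : ℝ) : ℂ) * Complex.exp (2 * Real.pi * Complex.I *
      (ν k * φ k x : ℝ)) + α k x * (Complex.exp (2 * Real.pi * Complex.I * (ν k * φ k x : ℝ)) *
        (2 * Real.pi * Complex.I * (ν k * deriv (φ k) x : ℝ)))), fun x => ?_, ?_,
    ∑ k, (M + M * (2 * Real.pi * (|ν k| * M))), fun x => ?_⟩
  · exact HasDerivAt.fun_sum fun k _ => hasDerivAt_component (hα k) x
  · refine continuous_finsetSum _ fun k _ => ?_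
    have h1 := (hα k).continuous_deriv_amp
    have h2 := (hα k).smooth_amp.continuous
    have h3 := (hα k).smooth_phase.continuous
    have h4 := (hα k).contDiff_deriv_phase.continuous
    fun_prop
  · refine (norm_sum_le _ _).trans (Finset.sum_le_sum fun k _ => (norm_add_le _ _).trans
      (add_le_add ?_ ?_))
    · rw [norm_mul, norm_exp_two_pi_I, mul_one, Complex.norm_real]
      exact (hα k).deriv_amp_le x
    · rw [norm_mul, norm_mul, norm_exp_two_pi_I, one_mul, norm_mul, Complex.norm_real,
        Complex.norm_real]
      have h5 : ‖(2 * Real.pi * Complex.I : ℂ)‖ = 2 * Real.pi := by simp [abs_of_pos Real.pi_pos]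
      rw [h5, norm_mul, Real.norm_eq_abs, Real.norm_eq_abs, Real.norm_eq_abs]
      gcongr
      · exact (hα k).abs_amp_le hM x
      · exact (hα k).deriv_phase_le x

end Superposition

/-! ### Frequency threshold, size of `|a|` in a band, and elementary bounds -/

section Estimates

lemma mul_rpow_neg_le_of_rpow_div_le {L ε t ν : ℝ} (hL : 0 < L) (hε : 0 < ε) (ht : 0 < t)
    (h : (L / ε) ^ (1 / t) ≤ ν) : L * ν ^ (-t) ≤ ε := by
  have h0 : 0 < (L / ε) ^ (1 / t) := Real.rpow_pos_of_pos (by positivity) _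
  have hν : 0 < ν := h0.trans_le h
  have h1 := Real.rpow_le_rpow h0.le h ht.le
  rw [← Real.rpow_mul (by positivity), one_div_mul_cancel ht.ne', Real.rpow_one] at h1
  rw [Real.rpow_neg hν.le, ← div_eq_mul_inv, div_le_iff₀ (by positivity)]
  rwa [div_le_iff₀ hε, mul_comm] at h1

/-- The condition `L ν^{-t} ≤ ε` holds once `ν ≥ (L/ε)^{1/t}`; the exponents `t = 2s - 1` and `t = 1
- s` are those of the two approximation errors. The factors `L^{1/t}` make `C₀` depend on `s`. The
bound `A ≤ ν` is absorbed since the powers of `ε` are at least 1. -/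
lemma exists_frequency_threshold {s : ℝ} (hs0 : 1 / 2 < s) (hs1 : s < 1) (A : ℝ) {L : ℝ}
    (hL : 0 < L) :
    ∃ C₀ > (0 : ℝ), ∀ ε : ℝ, 0 < ε → ε < 1 → ∀ ν : ℝ,
      C₀ * max (ε ^ (-1 / (2 * s - 1))) (ε ^ (-1 / (1 - s))) < ν →
      A ≤ ν ∧ L * ν ^ (1 - 2 * s) ≤ ε ∧ L * ν ^ (s - 1) ≤ ε := by
  have hp1 : 0 < L ^ (1 / (2 * s - 1)) := Real.rpow_pos_of_pos hL _
  have hp2 : 0 < L ^ (1 / (1 - s)) := Real.rpow_pos_of_pos hL _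
  set C₀ := max A (max (L ^ (1 / (2 * s - 1))) (L ^ (1 / (1 - s)))) with hC
  have hC1 : L ^ (1 / (2 * s - 1)) ≤ C₀ := (le_max_left _ _).trans (le_max_right _ _)
  have hC2 : L ^ (1 / (1 - s)) ≤ C₀ := (le_max_right _ _).trans (le_max_right _ _)
  have hC0 : 0 < C₀ := hp1.trans_le hC1
  refine ⟨C₀, hC0, fun ε hε0 hε1 ν hν => ?_⟩
  have hdiv : ∀ t : ℝ, 0 < t → L ^ (1 / t) ≤ C₀ →
      ε ^ (-1 / t) ≤ max (ε ^ (-1 / (2 * s - 1))) (ε ^ (-1 / (1 - s))) → L * ν ^ (-t) ≤ ε := by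
    intro t ht h1 h2
    apply mul_rpow_neg_le_of_rpow_div_le hL hε0 ht
    rw [Real.div_rpow hL.le hε0.le, div_eq_mul_inv, ← Real.rpow_neg hε0.le,
      show -(1 / t) = -1 / t by ring]
    have : 0 < ε ^ (-1 / t) := Real.rpow_pos_of_pos hε0 _
    exact (mul_le_mul h1 h2 this.le hC0.le).trans hν.le
  refine ⟨?_, ?_, ?_⟩
  · have h1 : 1 ≤ ε ^ (-1 / (1 - s)) := by
      apply Real.one_le_rpow_of_pos_of_le_one_of_nonpos hε0 hε1.le
      exact div_nonpos_of_nonpos_of_nonneg (by norm_num) (by linarith)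
    have h2 : C₀ * 1 ≤ C₀ * max (ε ^ (-1 / (2 * s - 1))) (ε ^ (-1 / (1 - s))) :=
      mul_le_mul_of_nonneg_left (h1.trans (le_max_right _ _)) hC0.le
    have h3 : A ≤ C₀ := le_max_left _ _
    linarith
  · have := hdiv (2 * s - 1) (by linarith) hC1 (le_max_left _ _)
    rwa [neg_sub] at this
  · have := hdiv (1 - s) (by linarith) hC2 (le_max_right _ _)
    rwa [neg_sub] at this

/-- Subadditivity holds for the outer measure, so neither event has to be measurable. -/
lemma one_sub_le_measureReal {Ω : Type*} [MeasurableSpace Ω] {P : Measure Ω}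
    [IsProbabilityMeasure P] {S T : Set Ω} (h : ∀ ω, ω ∉ S → ω ∈ T) {x : ℝ} (hT : P.real T ≤ x) :
    1 - x ≤ P.real S := by
  have h1 : P.real univ ≤ P.real (S ∪ T) :=
    measureReal_mono fun ω _ => by
      by_cases hS : ω ∈ S
      · exact Or.inl hS
      · exact Or.inr (h ω hS)
  have h2 := measureReal_union_le (μ := P) S T
  simp only [probReal_univ] at h1
  linarith

/-- The band has half-width `|a|^s` with `s < 1`, of lower order than `ν` at high frequency, so
`|a|` is comparable to `ν |φ'(b)|`. For the upper bound, `|a| > 2Mν` would give `|a|^s ≤ |a| / 2`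
and hence `|a| ≤ 2Mν`. -/
lemma abs_fst_of_mem_Zset {M s ν a b : ℝ} {α φ : ℝ → ℝ} (hα : IsModeType M α φ) (hM : 1 ≤ M)
    (hs0 : 0 < s) (hs1 : s < 1) (hν : 2 * M ≤ ν) (hν' : 2 * ν ^ (s - 1) ≤ 1)
    (hZ : (a, b) ∈ Zset s ν φ) : ν / (2 * M) ≤ |a| ∧ |a| ≤ 2 * M * ν := by
  have hM0 : 0 < M := by linarith
  have hν0 : 0 < ν := by linarith
  have hZ' : |a - ν * deriv φ b| ≤ |a| ^ s := hZ
  have h1 : ν / M ≤ |ν * deriv φ b| := by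
    rw [abs_mul, abs_of_pos hν0, div_eq_mul_one_div]
    exact mul_le_mul_of_nonneg_left (hα.deriv_phase_ge b) hν0.le
  have h2 : |ν * deriv φ b| ≤ M * ν := by
    rw [abs_mul, abs_of_pos hν0, mul_comm]
    exact mul_le_mul_of_nonneg_right (hα.deriv_phase_le b) hν0.le
  constructor
  · by_contra! h
    have h3 : |a| ^ s ≤ ν / (2 * M) := by
      rcases le_total |a| 1 with h4 | h4
      · refine (Real.rpow_le_one (abs_nonneg a) h4 hs0.le).trans ?_
        rwa [one_le_div (by positivity)]
      · exact (Real.rpow_le_self_of_one_le h4 hs1.le).trans h.le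
    have h5 : ν / M = ν / (2 * M) + ν / (2 * M) := by field_simp; ring
    have h6 := abs_sub_abs_le_abs_sub (ν * deriv φ b) a
    rw [abs_sub_comm] at h6
    linarith
  · by_contra! h
    have hνM : ν ≤ 2 * M * ν := le_mul_of_one_le_left hν0.le (by linarith)
    have ha0 : 0 < |a| := by linarith
    have h3 : |a| ^ (s - 1) ≤ ν ^ (s - 1) :=
      Real.rpow_le_rpow_of_nonpos hν0 (by linarith) (by linarith)
    have h4 : |a| ^ s = |a| * |a| ^ (s - 1) := by
      rw [Real.rpow_sub_one ha0.ne']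
      field_simp
    have h6 := abs_sub_abs_le_abs_sub a (ν * deriv φ b)
    nlinarith

lemma relErr_div_le (z X : ℂ) (hX : X ≠ 0) {ν : ℝ} {φ : ℝ → ℝ} {b : ℝ} :
    relErr (z / (2 * Real.pi * Complex.I * X)) ν φ b ≤
      ‖z - ((2 * Real.pi * (ν * deriv φ b) : ℝ) : ℂ) * Complex.I * X‖ /
        (‖X‖ * |ν * deriv φ b|) := by
  set μ := ν * deriv φ b
  have h0 : (2 * Real.pi * Complex.I * X : ℂ) ≠ 0 := by
    simp [hX, Real.pi_ne_zero]
  have h1 : z / (2 * Real.pi * Complex.I * X) - (μ : ℂ) =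
      (z - ((2 * Real.pi * μ : ℝ) : ℂ) * Complex.I * X) / (2 * Real.pi * Complex.I * X) := by
    rw [eq_div_iff h0, sub_mul, div_mul_cancel₀ _ h0]
    push_cast
    ring
  have h2 : ‖(2 * Real.pi * Complex.I * X : ℂ)‖ = 2 * Real.pi * ‖X‖ := by
    simp [abs_of_pos Real.pi_pos]
  rw [relErr, h1, norm_div, h2, div_div]
  have hXn := norm_pos_iff.2 hX
  -- For `μ = 0` both sides vanish by the convention for division by zero; otherwise the factor `1 /
  -- (2π)` is discarded.
  rcases (abs_nonneg μ).eq_or_lt with h | h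
  · rw [← h]; simp
  · gcongr
    have := Real.pi_gt_three
    nlinarith

end Estimates

/-! ### Tail bounds for the noise in `W_g` and in `∂_b W_g - 2πi μ W_g` -/

section Tails

variable {Ω : Type*} [MeasurableSpace Ω] {P : Measure Ω} [IsProbabilityMeasure P]
  {v : ℝ} {e : Lp ℝ 2 (volume : Measure ℝ) → Ω → ℝ}
  {s a b ε B : ℝ} {m : ℕ} {w : ℝ → ℂ}

/-- A constant controlling the variances of all noise terms. -/
noncomputable def noiseScale (B : ℝ) (m : ℕ) : ℝ :=
  4 * (4 * Real.pi ^ 2 + 2 * Real.pi) * (fourierMass B m * B) + 1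

lemma noiseScale_pos (hB : 0 ≤ B) : 0 < noiseScale B m := by
  have := fourierMass_nonneg (m := m) hB
  unfold noiseScale
  positivity

lemma norm_integral_sq_le (u : ℝ → ℂ) : ‖∫ x, u x ^ 2‖ ≤ ∫ x, ‖u x‖ ^ 2 := by
  refine (norm_integral_le_integral_norm _).trans (le_of_eq ?_)
  simp only [norm_pow]

lemma IsMotherPacket.integrable_normSq (hw : IsMotherPacket ε m w) (hB : PacketSize B w)
    (hε : ε < 1) (hm : 3 ≤ m) : Integrable fun x => ‖w x‖ ^ 2 :=
  integrable_sq_of_bounded hw.continuous hw.integrable (hw.norm_le hB hε hm)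

lemma IsMotherPacket.integrable_normSq_deriv (hw : IsMotherPacket ε m w) (hB : PacketSize B w)
    (hε : ε < 1) (hm : 3 ≤ m) : Integrable fun x => ‖deriv w x‖ ^ 2 :=
  integrable_sq_of_bounded (hw.continuous_deriv hm) hB.integrable_deriv (hw.norm_deriv_le hB hε hm)

/-- Tail bound for the noise in the wave packet transform, up to a constant in the exponent. -/
lemma packet_noise_tail (he : IsWhiteNoise P v e) (hv : 0 < v) (hw : IsMotherPacket ε m w)
    (hB : PacketSize B w) (hε : ε < 1) (hm : 3 ≤ m) (ha : a ≠ 0) {t : ℝ} (ht : 0 ≤ t) :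
    P.real {ω | t ≤ ‖pairing e (packet w s a b) ω‖} ≤ Real.exp (-(t ^ 2 / (v * noiseScale B m))) := by
  have hB0 := hB.pos hw
  refine he.pairing_tail hv (memLp_packet ha hw.continuous (hw.integrable_normSq hB hε hm))
    (noiseScale_pos hB0.le) ?_ ht
  have h1 := norm_integral_sq_le (packet w s a b)
  rw [integral_normSq_packet ha] at h1 ⊢
  have h2 : ∫ x, ‖w x‖ ^ 2 ≤ fourierMass B m * B := hw.normSq_le hB hε hm
  have h3 := mul_nonneg (fourierMass_nonneg (m := m) hB0.le) hB0.le
  have hpi := Real.pi_gt_three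
  unfold noiseScale
  nlinarith [mul_nonneg (sq_nonneg Real.pi) h3, mul_nonneg Real.pi_pos.le h3]

/-- A slightly enlarged variance is traded for an additive error, uniformly in `x`, because `y
exp(-y) ≤ 1`. This keeps the exponent `‖w‖^{-2}` in the third claim free of constants. -/
lemma exp_neg_div_add_le {x S κ : ℝ} (hx : 0 ≤ x) (hS : 0 < S) (hκ : 0 ≤ κ) :
    Real.exp (-(x / (S + κ))) ≤ Real.exp (-(x / S)) + κ / S := by
  set y := x / (S + κ) with hy
  have hy0 : 0 ≤ y := by positivity
  have hxy : x / S = y + y * (κ / S) := by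
    rw [hy]
    field_simp
  have h1 : Real.exp (-(x / S)) = Real.exp (-y) * Real.exp (-(y * (κ / S))) := by
    rw [hxy, ← Real.exp_add]
    ring_nf
  have h2 : 1 - y * (κ / S) ≤ Real.exp (-(y * (κ / S))) := by
    linarith [Real.add_one_le_exp (-(y * (κ / S)))]
  have h3 : Real.exp (-y) * y ≤ 1 := by
    rw [Real.exp_neg, inv_mul_le_iff₀ (Real.exp_pos _)]
    linarith [Real.add_one_le_exp y]
  have h4 : Real.exp (-y) * (y * (κ / S)) ≤ κ / S := by
    rw [← mul_assoc]
    exact mul_le_of_le_one_left (by positivity) h3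
  rw [h1]
  nlinarith [mul_le_mul_of_nonneg_left h2 (Real.exp_pos (-y)).le]

/-- Sharp tail bound for the noise in the wave packet transform at high frequency. -/
lemma packet_noise_tail_sharp (he : IsWhiteNoise P v e) (hv : 0 < v) (hw : IsMotherPacket ε m w)
    (hB : PacketSize B w) (hε0 : 0 < ε) (hε : ε < 1) (hm : 3 ≤ m) (hs : s < 1) (ha : 1 ≤ |a|)
    {t : ℝ} (ht : 0 ≤ t) :
    P.real {ω | t ≤ ‖pairing e (packet w s a b) ω‖} ≤
      Real.exp (-(t ^ 2 / v / normSqL2 w)) +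
        2 * fourierMass B m * B * (ε / |a| ^ (m * (1 - s))) := by
  have hB0 := hB.pos hw
  have ha0 : 0 < |a| := by linarith
  have ha' : a ≠ 0 := abs_pos.1 ha0
  have hS : B⁻¹ ≤ normSqL2 w := hB.inv_le_normSq
  have hS0 : 0 < normSqL2 w := (inv_pos.2 hB0).trans_le hS
  have hF := fourierMass_nonneg (m := m) hB0.le
  set κ := 2 * fourierMass B m * (ε / |a| ^ (m * (1 - s))) with hκ
  have hκ0 : 0 ≤ κ := by positivity
  have hc : |2 * a * (|a| ^ s)⁻¹| / 2 = |a| ^ (1 - s) := by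
    rw [abs_mul, abs_mul, abs_of_pos (inv_pos.2 (Real.rpow_pos_of_pos ha0 s)),
      Real.rpow_sub ha0, Real.rpow_one]
    simp
    field_simp
  -- This makes the modulation frequency at least 2 in modulus, as the bound on the modulated square
  -- requires.
  have hone : 1 ≤ |a| ^ (1 - s) := Real.one_le_rpow ha (by linarith)
  have hle : ‖∫ x, packet w s a b x ^ 2‖ ≤ κ := by
    rw [integral_sq_packet ha']
    refine (hw.norm_integral_sq_modulated_le hB hε0 hε hm (by linarith)).trans ?_
    rw [hc, hκ]
    have : |a| ^ (m * (1 - s)) ≤ (1 + |a| ^ (1 - s)) ^ m := by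
      rw [mul_comm, Real.rpow_mul ha0.le, Real.rpow_natCast]
      gcongr
      linarith
    gcongr
  have h1 := he.pairing_tail hv (memLp_packet (s := s) (b := b) ha' hw.continuous
    (hw.integrable_normSq hB hε hm)) (L := normSqL2 w + κ) (by positivity)
    (by rw [integral_normSq_packet ha']; exact add_le_add le_rfl hle) ht
  refine h1.trans ?_
  rw [← div_div]
  refine (exp_neg_div_add_le (by positivity) hS0 hκ0).trans (add_le_add le_rfl ?_)
  rw [div_eq_mul_inv, hκ]
  have : (normSqL2 w)⁻¹ ≤ B := inv_le_of_inv_le₀ hB0 hS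
  calc _ ≤ 2 * fourierMass B m * (ε / |a| ^ (m * (1 - s))) * B := by gcongr
    _ = _ := by ring

/-- Tail bound for the noise in the numerator of `v_g - ν φ'(b)`. -/
lemma derivative_noise_tail (he : IsWhiteNoise P v e) (hv : 0 < v) (hw : IsMotherPacket ε m w)
    (hB : PacketSize B w) (hε : ε < 1) (hm : 3 ≤ m) (ha : a ≠ 0) {μ : ℝ} (hμ : |a - μ| ≤ |a| ^ s)
    {t : ℝ} (ht : 0 ≤ t) :
    P.real {ω | t ≤ ‖pairing e (packetDeriv w s a b) ω -
        ((2 * Real.pi * μ : ℝ) : ℂ) * Complex.I * pairing e (packet w s a b) ω‖} ≤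
      Real.exp (-(t ^ 2 / (v * ((|a| ^ s) ^ 2 * noiseScale B m)))) := by
  have hB0 := hB.pos hw
  have hl := Real.rpow_pos_of_pos (abs_pos.2 ha) s
  have hwd := hw.differentiable hm
  have m1 := memLp_packet (s := s) (b := b) ha hw.continuous (hw.integrable_normSq hB hε hm)
  have m2 := memLp_packet (s := s) (b := b) ha (hw.continuous_deriv hm)
    (hw.integrable_normSq_deriv hB hε hm)
  have m3 : MemLp (packetDeriv w s a b) 2 volume := by
    rw [show packetDeriv w s a b = fun x => -(2 * Real.pi * Complex.I * a) * packet w s a b x -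
        ((|a| ^ s : ℝ) : ℂ) * packet (deriv w) s a b x from funext fun x => packetDeriv_eq hwd x]
    exact (m1.const_mul _).sub (m2.const_mul _)
  set u : ℝ → ℂ := fun x => packetDeriv w s a b x +
    ((2 * Real.pi * μ : ℝ) : ℂ) * Complex.I * packet w s a b x with hu
  have mu : MemLp u 2 volume := m3.add (m1.const_mul _)
  have hae := he.pairing_add_mul m3 m1 (2 * Real.pi * μ)
  have hset : P.real {ω | t ≤ ‖pairing e (packetDeriv w s a b) ω -
        ((2 * Real.pi * μ : ℝ) : ℂ) * Complex.I * pairing e (packet w s a b) ω‖} =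
      P.real {ω | t ≤ ‖pairing e u ω‖} := by
    apply measureReal_congr
    filter_upwards [hae] with ω hω
    apply propext
    change t ≤ ‖_‖ ↔ t ≤ ‖pairing e u ω‖
    rw [hω]
  rw [hset]
  refine he.pairing_tail hv mu (mul_pos (by positivity) (noiseScale_pos hB0.le)) ?_ ht
  have hpt : ∀ x, ‖u x‖ ^ 2 ≤ 2 * (4 * Real.pi ^ 2 * (|a| ^ s) ^ 2) * ‖packet w s a b x‖ ^ 2 +
      2 * (|a| ^ s) ^ 2 * ‖packet (deriv w) s a b x‖ ^ 2 := by
    intro x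
    -- The carrier contributes only through `a - μ`, which is at most `|a|^s` inside the band. Thus
    -- `u` has `L²` norm of order `|a|^s` rather than `|a|`.
    have e1 : u x = -(2 * Real.pi * Complex.I * ((a - μ : ℝ) : ℂ)) * packet w s a b x -
        ((|a| ^ s : ℝ) : ℂ) * packet (deriv w) s a b x := by
      rw [hu]
      simp only [packetDeriv_eq hwd]
      push_cast
      ring
    have e2 : ‖u x‖ ≤ 2 * Real.pi * |a| ^ s * ‖packet w s a b x‖ +
        |a| ^ s * ‖packet (deriv w) s a b x‖ := by
      rw [e1]
      refine (norm_sub_le _ _).trans (add_le_add ?_ ?_)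
      · rw [norm_mul, norm_neg, norm_mul, Complex.norm_real, Real.norm_eq_abs]
        have h5 : ‖(2 * Real.pi * Complex.I : ℂ)‖ = 2 * Real.pi := by
          simp [abs_of_pos Real.pi_pos]
        rw [h5]
        gcongr
      · rw [norm_mul, Complex.norm_real, Real.norm_of_nonneg hl.le]
    calc ‖u x‖ ^ 2 ≤ (2 * Real.pi * |a| ^ s * ‖packet w s a b x‖ +
        |a| ^ s * ‖packet (deriv w) s a b x‖) ^ 2 := by gcongr
      _ ≤ _ := by
        nlinarith [sq_nonneg (2 * Real.pi * |a| ^ s * ‖packet w s a b x‖ -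
          |a| ^ s * ‖packet (deriv w) s a b x‖)]
  have hi1 := (integrable_normSq_packet (s := s) (b := b) ha
    (hw.integrable_normSq hB hε hm)).const_mul (2 * (4 * Real.pi ^ 2 * (|a| ^ s) ^ 2))
  have hi2 := (integrable_normSq_packet (s := s) (b := b) ha
    (hw.integrable_normSq_deriv hB hε hm)).const_mul (2 * (|a| ^ s) ^ 2)
  have hint : ∫ x, ‖u x‖ ^ 2 ≤ (|a| ^ s) ^ 2 *
      (2 * (4 * Real.pi ^ 2 + 2 * Real.pi) * (fourierMass B m * B)) := by
    refine (integral_mono ((memLp_two_iff_integrable_sq_norm mu.1).1 mu) (hi1.fun_add hi2)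
      hpt).trans ?_
    rw [integral_add hi1 hi2, integral_const_mul, integral_const_mul, integral_normSq_packet ha,
      integral_normSq_packet ha]
    have k1 : ∫ x, ‖w x‖ ^ 2 ≤ fourierMass B m * B := hw.normSq_le hB hε hm
    have k2 := hw.normSq_deriv_le hB hε hm
    calc _ ≤ 2 * (4 * Real.pi ^ 2 * (|a| ^ s) ^ 2) * (fourierMass B m * B) +
        2 * (|a| ^ s) ^ 2 * (2 * Real.pi * fourierMass B m * B) := by gcongr
      _ = _ := by ring
  have h1 := norm_integral_sq_le u
  unfold noiseScale
  nlinarith [sq_nonneg (|a| ^ s)]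

end Tails

/-! ### Probability estimates outside and inside the bands -/

section Inside

variable {Ω : Type*} [MeasurableSpace Ω] {P : Measure Ω} [IsProbabilityMeasure P]
  {e : Lp ℝ 2 (volume : Measure ℝ) → Ω → ℝ}
  {M s a b ε ε₁ q p B : ℝ} {m K : ℕ} {w : ℝ → ℂ} {α φ : Fin K → ℝ → ℝ} {ν : Fin K → ℝ}

/-- Threshold squared over variance is `ε₁^{-q-2p}`, and `ε₁ ≤ 1`. -/
lemma rpow_neg_le_ratio (h0 : 0 < ε₁) (h1 : ε₁ ≤ 1) (hp : 0 < p) :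
    ε₁ ^ (-q) ≤ (ε₁ ^ (1 / 2 - p)) ^ 2 / ε₁ ^ (1 + q) := by
  rw [← Real.rpow_natCast, ← Real.rpow_mul h0.le, ← Real.rpow_sub h0]
  apply Real.rpow_le_rpow_of_exponent_ge h0 h1
  push_cast
  linarith

/-- Outside of the bands, a large coefficient comes from the noise. -/
lemma prob_Rset_outside (he : IsWhiteNoise P (ε₁ ^ (1 + q)) e) (h0 : 0 < ε₁) (h1 : ε₁ ≤ 1)
    (hp : 0 < p) (hw : IsMotherPacket ε m w) (hB : PacketSize B w) (hε : ε < 1) (hm : 3 ≤ m)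
    (ha : a ≠ 0) {f : ℝ → ℂ} {Z : Prop}
    (hf : ¬ Z → ‖transform w s f a b‖ ≤ (|a| ^ (s / 2))⁻¹ * √ε) :
    1 - Real.exp (-(|a| ^ (-s) * ε₁ ^ (-q) / noiseScale B m)) ≤
      P.real {ω | (a, b) ∈ Rset w s f e (√ε + ε₁ ^ (1 / 2 - p)) ω → Z} := by
  have hB0 := hB.pos hw
  have hQ := noiseScale_pos (m := m) hB0.le
  have ha0 := abs_pos.2 ha
  have hr : 0 < |a| ^ (s / 2) := Real.rpow_pos_of_pos ha0 _
  have hr' : |a| ^ (-s / 2) = (|a| ^ (s / 2))⁻¹ := by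
    rw [neg_div, Real.rpow_neg ha0.le]
  have ht := Real.rpow_pos_of_pos h0 (1 / 2 - p)
  have hv := Real.rpow_pos_of_pos h0 (1 + q)
  -- The signal uses up the part `|a|^{-s/2} √ε` of the threshold, so the noise alone must exceed
  -- the rest.
  refine one_sub_le_measureReal (T := {ω | (|a| ^ (s / 2))⁻¹ * ε₁ ^ (1 / 2 - p) ≤
    ‖pairing e (packet w s a b) ω‖}) (fun ω hω => ?_)
    ((packet_noise_tail he hv hw hB hε hm ha (by positivity)).trans ?_)
  · obtain ⟨⟨-, hR⟩, hZ⟩ := Classical.not_imp.1 hω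
    simp only [hr', noisyTransform] at hR
    have h2 := norm_add_le (transform w s f a b) (pairing e (packet w s a b) ω)
    have h3 := hf hZ
    change (_ : ℝ) ≤ _
    rw [mul_add] at hR
    linarith
  · apply Real.exp_le_exp.2
    rw [neg_le_neg_iff, ← div_div]
    have h4 := rpow_neg_le_ratio (q := q) h0 h1 hp
    rw [mul_pow, inv_pow, rpow_half_sq, Real.rpow_neg ha0.le,
      mul_div_assoc (|a| ^ s)⁻¹ _ (ε₁ ^ (1 + q))]
    gcongr

/-- The threshold carries no weight `|a|^{-s/2}`, so the exponent no longer depends on `a`, and the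
sharp tail supplies `‖w‖^{-2}`. For `|a| ≥ 1` the signal is still below `√ε`. -/
lemma prob_Sset_outside (he : IsWhiteNoise P (ε₁ ^ (1 + q)) e) (h0 : 0 < ε₁) (h1 : ε₁ ≤ 1)
    (hp : 0 < p) (hw : IsMotherPacket ε m w) (hB : PacketSize B w) (hε0 : 0 < ε) (hε : ε < 1)
    (hm : 3 ≤ m) (hs0 : 0 < s) (hs : s < 1) (ha : 1 ≤ |a|) {f : ℝ → ℂ} {Z : Prop}
    (hf : ¬ Z → ‖transform w s f a b‖ ≤ (|a| ^ (s / 2))⁻¹ * √ε) :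
    1 - (Real.exp (-(ε₁ ^ (-q) * (normSqL2 w)⁻¹)) +
        2 * fourierMass B m * B * (ε / |a| ^ (m * (1 - s)))) ≤
      P.real {ω | (a, b) ∈ Sset w s f e (√ε + ε₁ ^ (1 / 2 - p)) ω → Z} := by
  have hr : (|a| ^ (s / 2))⁻¹ ≤ 1 := inv_le_one_of_one_le₀ (Real.one_le_rpow ha (by linarith))
  have ht := Real.rpow_pos_of_pos h0 (1 / 2 - p)
  have hv := Real.rpow_pos_of_pos h0 (1 + q)
  refine one_sub_le_measureReal (T := {ω | ε₁ ^ (1 / 2 - p) ≤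
    ‖pairing e (packet w s a b) ω‖}) (fun ω hω => ?_)
    ((packet_noise_tail_sharp he hv hw hB hε0 hε hm hs ha ht.le).trans ?_)
  · obtain ⟨⟨-, hR⟩, hZ⟩ := Classical.not_imp.1 hω
    simp only [noisyTransform] at hR
    have h2 := norm_add_le (transform w s f a b) (pairing e (packet w s a b) ω)
    have h3 : ‖transform w s f a b‖ ≤ √ε :=
      (hf hZ).trans (mul_le_of_le_one_left (Real.sqrt_nonneg _) hr)
    change (_ : ℝ) ≤ _
    linarith
  · refine add_le_add (Real.exp_le_exp.2 ?_) le_rfl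
    have h4 := rpow_neg_le_ratio (q := q) h0 h1 hp
    have h5 : 0 < normSqL2 w := (inv_pos.2 (hB.pos hw)).trans_le hB.inv_le_normSq
    rw [neg_le_neg_iff, ← div_eq_mul_inv]
    gcongr

/-- Inside of a band, the information function of the signal is close to the local frequency. -/
lemma norm_deriv_transform_sub_le (hα : ∀ k, IsModeType M (α k) (φ k)) (hM : 0 < M)
    (hw : IsMotherPacket ε m w) (hB : PacketSize B w) (hm : 3 ≤ m) (ha : a ≠ 0) {μ : ℝ}
    (hμ : |a - μ| ≤ |a| ^ s) :
    ‖deriv (fun b' => transform w s (superposition α φ ν) a b') b -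
      ((2 * Real.pi * μ : ℝ) : ℂ) * Complex.I * transform w s (superposition α φ ν) a b‖ ≤
      8 * K * M * B * |a| ^ (s / 2) := by
  have hB0 := hB.pos hw
  have hr : 0 < |a| ^ (s / 2) := Real.rpow_pos_of_pos (abs_pos.2 ha) _
  obtain ⟨f', hf', hcf', F', hF'⟩ := exists_deriv_superposition (ν := ν) hα hM
  have hF := norm_superposition_le (ν := ν) hα hM
  have h1 := deriv_transform (b := b) (s := s) (hw.differentiable hm) hw.integrable
    (hw.continuous_deriv hm) hB.integrable_deriv hf' hcf' hF hF' ha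
  have h2 : ‖transform w s (superposition α φ ν) a b‖ ≤ K * M * ((|a| ^ (s / 2))⁻¹ * B) := by
    refine (norm_integral_mul_conj_packet_le hF hw.continuous hw.integrable ha).trans ?_
    have := hB.integral_norm_le hw.integrable
    gcongr
  have h3 : ‖transform (deriv w) s (superposition α φ ν) a b‖ ≤
      K * M * ((|a| ^ (s / 2))⁻¹ * B) := by
    refine (norm_integral_mul_conj_packet_le hF (hw.continuous_deriv hm) hB.integrable_deriv
      ha).trans ?_
    have := hB.deriv_le
    gcongr
  have h4 : deriv (fun b' => transform w s (superposition α φ ν) a b') b -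
      ((2 * Real.pi * μ : ℝ) : ℂ) * Complex.I * transform w s (superposition α φ ν) a b =
      ((2 * Real.pi * (a - μ) : ℝ) : ℂ) * Complex.I * transform w s (superposition α φ ν) a b -
        ((|a| ^ s : ℝ) : ℂ) * transform (deriv w) s (superposition α φ ν) a b := by
    rw [h1]
    push_cast
    ring
  have hsq : |a| ^ s = |a| ^ (s / 2) * |a| ^ (s / 2) := by rw [← sq, rpow_half_sq]
  rw [h4]
  refine (norm_sub_le _ _).trans ?_
  rw [norm_mul, norm_mul, norm_mul, Complex.norm_I, mul_one, Complex.norm_real, Complex.norm_real,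
    Real.norm_eq_abs, Real.norm_of_nonneg (by positivity : 0 ≤ |a| ^ s), abs_mul,
    abs_of_pos (by positivity : 0 < 2 * Real.pi)]
  calc _ ≤ 2 * 3.15 * |a| ^ s * (K * M * ((|a| ^ (s / 2))⁻¹ * B)) +
        |a| ^ s * (K * M * ((|a| ^ (s / 2))⁻¹ * B)) := by
        gcongr
        exact Real.pi_lt_d2.le
    _ = 7.3 * K * M * B * |a| ^ (s / 2) := by
        rw [hsq]
        field_simp
        ring
    _ ≤ _ := by gcongr; norm_num

/-- Inside of a band, wherever the noisy coefficient is large, the noisy information function is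
close to the local frequency with high probability. -/
lemma prob_inside (he : IsWhiteNoise P (ε₁ ^ (1 + q)) e) (h0 : 0 < ε₁) (hε0 : 0 < ε) (hε : ε < 1)
    (hw : IsMotherPacket ε m w) (hB : PacketSize B w) (hm : 3 ≤ m)
    (hα : ∀ k, IsModeType M (α k) (φ k)) (hM : 1 ≤ M) (hs0 : 0 < s) (hs1 : s < 1) {k : Fin K}
    (hν : 2 * M ≤ ν k) (hν' : 2 * ν k ^ (s - 1) ≤ ε) (hZ : (a, b) ∈ Zset s (ν k) (φ k))
    {ρ : ℝ} (hρ : 0 < ρ) :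
    1 - Real.exp (-(ν k ^ (2 - 3 * s) * ε₁ ^ (-q) / (4 * M ^ 2 * noiseScale B m))) ≤
      P.real {ω | ρ * (√ε + ε₁ ^ (1 / 2 - p)) ≤
          ‖noisyTransform w s (superposition α φ ν) e ω a b‖ →
        relErr (noisyInfo w s (superposition α φ ν) e ω a b) (ν k) (φ k) b ≤
          (16 * K * M ^ 3 * B + M) * ((√ε + ε₁ ^ p) / ν k ^ (s / 2)) / ρ} := by
  have hB0 := hB.pos hw
  have hM0 : 0 < M := by linarith
  have hQ := noiseScale_pos (m := m) hB0.le
  have hν0 : 0 < ν k := by linarith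
  obtain ⟨hal, hau⟩ := abs_fst_of_mem_Zset (hα k) hM hs0 hs1 hν (by linarith) hZ
  have ha0 : 0 < |a| := lt_of_lt_of_le (by positivity) hal
  have ha : a ≠ 0 := abs_pos.1 ha0
  set μ := ν k * deriv (φ k) b with hμ
  have hZ' : |a - μ| ≤ |a| ^ s := hZ
  have hμl : ν k / M ≤ |μ| := by
    rw [hμ, abs_mul, abs_of_pos hν0, div_eq_mul_one_div]
    exact mul_le_mul_of_nonneg_left ((hα k).deriv_phase_ge b) hν0.le
  have hv := Real.rpow_pos_of_pos h0 (1 + q)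
  have hδ := Real.rpow_pos_of_pos h0 (1 / 2 - p)
  have hsε : 0 < √ε := Real.sqrt_pos.2 hε0
  set y := ν k ^ (s / 2) with hy
  have hy0 : 0 < y := Real.rpow_pos_of_pos hν0 _
  have hpow : ∀ x : ℝ, 0 ≤ x → x ≤ 1 → (2 * M * ν k) ^ x ≤ 2 * M * ν k ^ x := fun x hx0 hx1 => by
    rw [Real.mul_rpow (by positivity) hν0.le]
    gcongr
    exact Real.rpow_le_self_of_one_le (by linarith) hx1
  have hra : |a| ^ (s / 2) ≤ 2 * M * y :=
    (Real.rpow_le_rpow ha0.le hau (by linarith)).trans (hpow _ (by linarith) (by linarith))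
  have hsa : |a| ^ s ≤ 2 * M * ν k ^ s :=
    (Real.rpow_le_rpow ha0.le hau hs0.le).trans (hpow _ hs0.le hs1.le)
  have hνs : 0 < ν k ^ s := Real.rpow_pos_of_pos hν0 _
  have hyy : y * y = ν k ^ s := by
    rw [hy, ← Real.rpow_add hν0]
    congr 1
    ring
  -- The noise level `√ε₁ ν^{1-s/2}` is chosen so that, since `√ε₁ = ε₁^{1/2-p} ε₁^p`, division by a
  -- multiple of `δ ν` leaves at most `ε₁^p ν^{-s/2}` up to constants.
  refine one_sub_le_measureReal (T := {ω | √ε₁ * (ν k / y) ≤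
    ‖pairing e (packetDeriv w s a b) ω -
        ((2 * Real.pi * μ : ℝ) : ℂ) * Complex.I * pairing e (packet w s a b) ω‖})
    (fun ω hω => ?_)
    ((derivative_noise_tail he hv hw hB hε hm ha hZ' (by positivity)).trans ?_)
  · change (_ : ℝ) ≤ _
    by_contra! hlt
    apply hω
    intro hX
    set X := noisyTransform w s (superposition α φ ν) e ω a b with hXdef
    have hXpos : 0 < ‖X‖ := lt_of_lt_of_le (by positivity) hX
    refine (relErr_div_le _ X (norm_pos_iff.1 hXpos)).trans ?_
    have hdet := norm_deriv_transform_sub_le (ν := ν) (b := b) hα hM0 hw hB hm ha hZ'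
    set T := transform w s (superposition α φ ν) a b
    set D := deriv (fun b' => transform w s (superposition α φ ν) a b') b
    have e1 : noisyTransformDeriv w s (superposition α φ ν) e ω a b -
        ((2 * Real.pi * μ : ℝ) : ℂ) * Complex.I * X =
        (D - ((2 * Real.pi * μ : ℝ) : ℂ) * Complex.I * T) +
        (pairing e (packetDeriv w s a b) ω -
        ((2 * Real.pi * μ : ℝ) : ℂ) * Complex.I * pairing e (packet w s a b) ω) := by
      simp only [noisyTransformDeriv, hXdef, noisyTransform, D, T]
      ring
    have hnum : ‖noisyTransformDeriv w s (superposition α φ ν) e ω a b -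
        ((2 * Real.pi * μ : ℝ) : ℂ) * Complex.I * X‖ ≤
        16 * K * M ^ 2 * B * y + √ε₁ * (ν k / y) := by
      rw [e1]
      refine (norm_add_le _ _).trans (add_le_add ?_ hlt.le)
      refine hdet.trans ?_
      calc 8 * K * M * B * |a| ^ (s / 2) ≤ 8 * K * M * B * (2 * M * y) := by gcongr
        _ = _ := by ring
    -- The signal error `O(ν^{s/2})` becomes `ε ν^{1-s/2}` at high frequency; after division by `δ ≥
    -- √ε` a factor `√ε` remains.
    have hyν : y ≤ ε * (ν k / y) := by
      rw [mul_div_assoc', le_div_iff₀ hy0, hyy]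
      have : ν k ^ s = ν k ^ (s - 1) * ν k := by
        rw [Real.rpow_sub_one hν0.ne']
        field_simp
      rw [this]
      have : 0 < ν k ^ (s - 1) := Real.rpow_pos_of_pos hν0 _
      gcongr
      linarith
    have hsqε : ε = √ε * √ε := (Real.mul_self_sqrt hε0.le).symm
    have hsqε₁ : √ε₁ = ε₁ ^ (1 / 2 - p) * ε₁ ^ p := by
      rw [← Real.rpow_add h0, sub_add_cancel, Real.sqrt_eq_rpow]
    have hp0 := Real.rpow_pos_of_pos h0 p
    have hμ0 : 0 < |μ| := lt_of_lt_of_le (div_pos hν0 hM0) hμl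
    rw [div_le_div_iff₀ (mul_pos hXpos hμ0) hρ]
    have hden : ρ * (√ε + ε₁ ^ (1 / 2 - p)) * (ν k / M) ≤ ‖X‖ * |μ| := by gcongr
    calc ‖noisyTransformDeriv w s (superposition α φ ν) e ω a b -
        ((2 * Real.pi * μ : ℝ) : ℂ) * Complex.I * X‖ * ρ
        ≤ (16 * K * M ^ 2 * B * (√ε * √ε * (ν k / y)) +
            ε₁ ^ (1 / 2 - p) * ε₁ ^ p * (ν k / y)) * ρ := by
          rw [← hsqε, ← hsqε₁]
          refine mul_le_mul_of_nonneg_right (hnum.trans ?_) hρ.le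
          gcongr
      _ ≤ (16 * K * M ^ 2 * B + 1) *
          ((√ε + ε₁ ^ (1 / 2 - p)) * (√ε + ε₁ ^ p) * (ν k / y)) * ρ := by
          gcongr
          have k1 : √ε * √ε * (ν k / y) ≤
              (√ε + ε₁ ^ (1 / 2 - p)) * (√ε + ε₁ ^ p) * (ν k / y) := by
            gcongr <;> linarith
          have k2 : ε₁ ^ (1 / 2 - p) * ε₁ ^ p * (ν k / y) ≤
              (√ε + ε₁ ^ (1 / 2 - p)) * (√ε + ε₁ ^ p) * (ν k / y) := by
            gcongr <;> linarith
          have k3 : 0 ≤ 16 * K * M ^ 2 * B := by positivity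
          nlinarith [mul_le_mul_of_nonneg_left k1 k3]
      _ = (16 * K * M ^ 3 * B + M) * ((√ε + ε₁ ^ p) / y) *
          (ρ * (√ε + ε₁ ^ (1 / 2 - p)) * (ν k / M)) := by
          field_simp
      _ ≤ _ := mul_le_mul_of_nonneg_left hden (by positivity)
  · apply Real.exp_le_exp.2
    rw [neg_le_neg_iff]
    -- The squared threshold is `ε₁ ν^{2-s}` and the variance at most of order `ε₁^{1+q} ν^{2s}`,
    -- whence the exponent `ν^{2-3s} ε₁^{-q}`.
    have e2 : (√ε₁ * (ν k / y)) ^ 2 = ε₁ * (ν k ^ 2 / ν k ^ s) := by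
      rw [mul_pow, Real.sq_sqrt h0.le, div_pow, sq y, hyy]
    have e3 : ε₁ / ε₁ ^ (1 + q) = ε₁ ^ (-q) := by
      rw [Real.rpow_add h0, Real.rpow_one, Real.rpow_neg h0.le]
      field_simp
    have e4 : ν k ^ (2 - 3 * s) = ν k ^ 2 / ν k ^ s / (ν k ^ s) ^ 2 := by
      rw [Real.rpow_sub hν0, show 3 * s = s * (3 : ℕ) by push_cast; ring, Real.rpow_mul hν0.le,
        Real.rpow_natCast, show (2 : ℝ) = ((2 : ℕ) : ℝ) by norm_num, Real.rpow_natCast]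
      field_simp
    calc ν k ^ (2 - 3 * s) * ε₁ ^ (-q) / (4 * M ^ 2 * noiseScale B m)
        = ε₁ * (ν k ^ 2 / ν k ^ s) /
          (ε₁ ^ (1 + q) * ((2 * M * ν k ^ s) ^ 2 * noiseScale B m)) := by
          rw [e4, ← e3]
          field_simp
          ring
      _ ≤ _ := by
          rw [e2]
          gcongr

end Inside

/-! ### Assembly of the theorem -/

/-- A product of two numbers of the form `1 - exp(·)` is at most its second factor when that factor
is nonnegative. A single tail with a larger power of `ν` therefore dominates the product in the
fourth and fifth claims. -/
lemma product_le_one_sub_exp {c d E R ν x y z : ℝ} (hν : 1 ≤ ν) (hd : 0 < d) (hE : 0 ≤ E)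
    (hR : 0 ≤ R) (hyz : y ≤ z) :
    (1 - Real.exp (-(c * ν ^ x * E))) * (1 - Real.exp (-(1 / d * ν ^ y * E))) - R ≤
      1 - Real.exp (-(ν ^ z * E / d)) := by
  have hν0 : 0 < ν := by linarith
  have hle : ν ^ y ≤ ν ^ z := Real.rpow_le_rpow_of_exponent_le hν hyz
  have hy0 : 0 < ν ^ y := Real.rpow_pos_of_pos hν0 _
  have g1 : Real.exp (-(ν ^ z * E / d)) ≤ Real.exp (-(1 / d * ν ^ y * E)) := by
    apply Real.exp_le_exp.2
    rw [neg_le_neg_iff, mul_assoc, one_div_mul_eq_div]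
    gcongr
  have g2 : Real.exp (-(1 / d * ν ^ y * E)) ≤ 1 :=
    Real.exp_le_one_iff.2 (neg_nonpos.2 (by positivity))
  have g3 := mul_nonneg (Real.exp_pos (-(c * ν ^ x * E))).le (sub_nonneg.2 g2)
  linarith

/-- Passing from `|a|` to a comparable frequency costs `(2M)^{m(1-s)}`, which is at most `(2M)^m`
and so independent of `s`. -/
lemma decay_rescale {M ε ν t s : ℝ} {m : ℕ} (hM : 1 ≤ M) (hν : 0 < ν) (hs0 : 0 < s) (hs1 : s < 1)
    (hε : 0 ≤ ε) (ht : ν / (2 * M) ≤ t) :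
    ε / t ^ (m * (1 - s)) ≤ (2 * M) ^ m * (ε / ν ^ (m * (1 - s))) := by
  have hM0 : 0 < M := by linarith
  have ht0 : 0 < t := lt_of_lt_of_le (by positivity) ht
  have hx0 : 0 ≤ m * (1 - s) := mul_nonneg (Nat.cast_nonneg m) (by linarith)
  have hx1 : m * (1 - s) ≤ m := mul_le_of_le_one_right (Nat.cast_nonneg m) (by linarith)
  have h6 : ν ≤ 2 * M * t := by
    rw [div_le_iff₀ (by positivity)] at ht
    linarith
  have h5 : ν ^ (m * (1 - s)) ≤ (2 * M) ^ m * t ^ (m * (1 - s)) := by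
    calc ν ^ (m * (1 - s)) ≤ (2 * M * t) ^ (m * (1 - s)) := Real.rpow_le_rpow hν.le h6 hx0
      _ = (2 * M) ^ (m * (1 - s)) * t ^ (m * (1 - s)) := Real.mul_rpow (by positivity) ht0.le
      _ ≤ _ := by
          gcongr
          rw [← Real.rpow_natCast]
          exact Real.rpow_le_rpow_of_exponent_le (by linarith) hx1
  have p1 : 0 < ν ^ (m * (1 - s)) := Real.rpow_pos_of_pos hν _
  have p2 : 0 < t ^ (m * (1 - s)) := Real.rpow_pos_of_pos ht0 _
  rw [mul_div_assoc', div_le_div_iff₀ p2 p1]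
  calc ε * ν ^ (m * (1 - s)) ≤ ε * ((2 * M) ^ m * t ^ (m * (1 - s))) := by gcongr
    _ = _ := by ring

/-- The concentration theorem for `M ≥ 1` and `B ≥ 1`. -/
theorem concentration_of_one_le (M : ℝ) (hM : 1 ≤ M) (K m : ℕ) (B : ℝ) (hB1 : 1 ≤ B) :
    ∃ c > (0 : ℝ), ∃ C > (0 : ℝ),
    ∀ s : ℝ, 1 / 2 < s → s < 1 → 2 / (1 - s) + 4 ≤ (m : ℝ) →
    ∃ C₀ > (0 : ℝ),
    ∀ ε : ℝ, 0 < ε → ε < 1 →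
    ∀ w : ℝ → ℂ, SST.IsMotherPacket ε m w → SST.PacketSize B w →
    ∀ N : ℝ, C₀ * max (ε ^ (-1 / (2 * s - 1))) (ε ^ (-1 / (1 - s))) < N →
    ∀ (α φ : Fin K → ℝ → ℝ) (ν : Fin K → ℝ), SST.IsWellSeparated M N K s α φ ν →
    ∀ ε₁ : ℝ, 0 < ε₁ → ε₁ ≤ 1 →
    ∀ q : ℝ, 0 < q → ∀ p : ℝ, 0 < p → p ≤ 1 / 2 →
    ∀ (Ω : Type*) [MeasurableSpace Ω] (P : MeasureTheory.Measure Ω)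
      [MeasureTheory.IsProbabilityMeasure P]
      (e : MeasureTheory.Lp ℝ 2 (MeasureTheory.volume : MeasureTheory.Measure ℝ) → Ω → ℝ),
    SST.IsWhiteNoise P (ε₁ ^ (1 + q)) e →
    ∀ f : ℝ → ℂ, f = SST.superposition α φ ν →
    ∀ δ : ℝ, δ = √ε + ε₁ ^ (1 / 2 - p) →
    (Pairwise fun j k : Fin K => Disjoint (SST.Zset s (ν j) (φ j)) (SST.Zset s (ν k) (φ k))) ∧
    (2 * M * K * √ε ≤ 2 ^ m →
      (∀ a b : ℝ, a ≠ 0 →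
        1 - Real.exp (-(c * |a| ^ (-s) * ε₁ ^ (-q))) - C * (ε / |a| ^ (m * (1 - s))) ≤
          P.real {ω | (a, b) ∈ SST.Rset w s f e δ ω → ∃ k, (a, b) ∈ SST.Zset s (ν k) (φ k)}) ∧
      (∀ (a b : ℝ) (k : Fin K), ν k / (2 * M) ≤ |a| → |a| ≤ 2 * M * ν k →
        1 - Real.exp (-(c * ν k ^ (-s) * ε₁ ^ (-q))) - C * (ε / ν k ^ (m * (1 - s))) ≤
          P.real {ω | (a, b) ∈ SST.Rset w s f e δ ω → ∃ j, (a, b) ∈ SST.Zset s (ν j) (φ j)}) ∧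
      (∀ a b : ℝ, 1 ≤ |a| →
        1 - Real.exp (-(ε₁ ^ (-q) * (SST.normSqL2 w)⁻¹)) - C * (ε / |a| ^ (m * (1 - s))) ≤
          P.real {ω | (a, b) ∈ SST.Sset w s f e δ ω → ∃ k, (a, b) ∈ SST.Zset s (ν k) (φ k)}) ∧
      (∀ (a b : ℝ) (k : Fin K), ν k / (2 * M) ≤ |a| → |a| ≤ 2 * M * ν k →
        1 - Real.exp (-(ε₁ ^ (-q) * (SST.normSqL2 w)⁻¹)) - C * (ε / ν k ^ (m * (1 - s))) ≤
          P.real {ω | (a, b) ∈ SST.Sset w s f e δ ω → ∃ j, (a, b) ∈ SST.Zset s (ν j) (φ j)})) ∧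
    (∀ (a b : ℝ) (k : Fin K), (a, b) ∈ SST.Zset s (ν k) (φ k) →
      (1 - Real.exp (-(c * ν k ^ (2 - 3 * s) * ε₁ ^ (-q)))) *
            (1 - Real.exp (-(c * ν k ^ (-s - 2) * ε₁ ^ (-q))))
          - C * (ε / ν k ^ ((m - 4) * (1 - s) - 2)) ≤
        P.real {ω | (a, b) ∈ SST.Rset w s f e δ ω →
          SST.relErr (SST.noisyInfo w s f e ω a b) (ν k) (φ k) b ≤ C * (√ε + ε₁ ^ p)}) ∧
    (∀ (a b : ℝ) (k : Fin K), (a, b) ∈ SST.Zset s (ν k) (φ k) →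
      (1 - Real.exp (-(c * ν k ^ (2 - 2 * s) * ε₁ ^ (-q)))) *
            (1 - Real.exp (-(c * ν k ^ (-2 : ℝ) * ε₁ ^ (-q))))
          - C * (ε / ν k ^ ((m - 4) * (1 - s) - 2)) ≤
        P.real {ω | (a, b) ∈ SST.Sset w s f e δ ω →
          SST.relErr (SST.noisyInfo w s f e ω a b) (ν k) (φ k) b ≤
            C * ((√ε + ε₁ ^ p) / ν k ^ (s / 2))}) := by
  have hM0 : 0 < M := by linarith
  have hB0 : 0 < B := by linarith
  have hQ := noiseScale_pos (m := m) hB0.le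
  have hF := fourierMass_nonneg (m := m) hB0.le
  set Q := noiseScale B m with hQdef
  set A := 16 * K * M ^ 3 * B + M with hA
  have hA0 : 0 < A := by positivity
  set G := 2 * fourierMass B m * B with hG
  have hG0 : 0 ≤ G := by positivity
  have h2M : 1 ≤ (2 * M) ^ m := one_le_pow₀ (by linarith)
  -- `c` is the constant in the exponent of `prob_inside`, the smallest that occurs. In `C`, the
  -- term `2 M A` serves the relative errors and `(2M)^m G` the additive error of the sharp tail.
  refine ⟨1 / (4 * M ^ 2 * Q), by positivity, 2 * M * A + (2 * M) ^ m * G, by positivity, ?_⟩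
  intro s hs0 hs1 hms
  have hm : 3 ≤ m := by
    have : 0 < 2 / (1 - s) := div_pos two_pos (by linarith)
    have : (3 : ℝ) ≤ m := by linarith
    exact_mod_cast this
  have hL2 : (2 : ℝ) ≤ 112 * (K + 1) * M ^ 4 * B := by
    have : 1 ≤ M ^ 4 := one_le_pow₀ hM
    have : (1 : ℝ) ≤ K + 1 := by linarith [(Nat.cast_nonneg K : (0 : ℝ) ≤ K)]
    calc (2 : ℝ) ≤ 112 * 1 * 1 * 1 := by norm_num
      _ ≤ _ := by gcongr
  obtain ⟨C₀, hC₀, hthr⟩ := exists_frequency_threshold hs0 hs1 (2 * M)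
    (L := 112 * (K + 1) * M ^ 4 * B) (by positivity)
  refine ⟨C₀, hC₀, ?_⟩
  intro ε hε0 hε1 w hw hB N hN α φ ν hsep ε₁ h0 h1 q hq p hp hp2 Ω _ P _ e he f hf δ hδ
  subst hf hδ
  have hN' : ∀ k, 2 * M ≤ ν k ∧ 112 * (K + 1) * M ^ 4 * B * ν k ^ (1 - 2 * s) ≤ ε ∧
      112 * (K + 1) * M ^ 4 * B * ν k ^ (s - 1) ≤ ε := fun k =>
    hthr ε hε0 hε1 (ν k) (hN.trans_le (hsep.freq_ge k))
  have hν1 : ∀ k, 1 ≤ ν k := fun k => by linarith [(hN' k).1]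
  have hν0 : ∀ k, 0 < ν k := fun k => by linarith [hν1 k]
  have hν2 : ∀ k, 2 * ν k ^ (s - 1) ≤ ε := fun k => by
    have h3 : 0 < ν k ^ (s - 1) := Real.rpow_pos_of_pos (hν0 k) _
    exact (mul_le_mul_of_nonneg_right hL2 h3.le).trans (hN' k).2.2
  have hεq : 0 < ε₁ ^ (-q) := Real.rpow_pos_of_pos h0 _
  have hsε := Real.sqrt_nonneg ε
  have hεp := (Real.rpow_pos_of_pos h0 p).le
  have hGle : G ≤ 2 * M * A + (2 * M) ^ m * G := by
    have : 0 < 2 * M * A := by positivity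
    nlinarith
  have hGle' : (2 * M) ^ m * G ≤ 2 * M * A + (2 * M) ^ m * G := by
    have : 0 < 2 * M * A := by positivity
    linarith
  have hC : 0 ≤ 2 * M * A + (2 * M) ^ m * G := by positivity
  have hMsq : 2 * M ≤ 4 * M ^ 2 := by nlinarith
  have hdecay : ∀ x : ℝ, 0 ≤ x → ∀ r : ℝ,
      0 ≤ (2 * M * A + (2 * M) ^ m * G) * (ε / x ^ r) := fun x hx r => by positivity
  have hcomp : ∀ x : ℝ, 0 < x → 1 / (4 * M ^ 2 * Q) * x ^ (-s) * ε₁ ^ (-q) ≤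
      (2 * M)⁻¹ * x ^ (-s) * ε₁ ^ (-q) / Q := fun x hx => by
    have : 0 < x ^ (-s) := Real.rpow_pos_of_pos hx _
    calc 1 / (4 * M ^ 2 * Q) * x ^ (-s) * ε₁ ^ (-q)
        = (4 * M ^ 2)⁻¹ * x ^ (-s) * ε₁ ^ (-q) / Q := by field_simp
      _ ≤ _ := by gcongr
  refine ⟨fun j k hjk => Set.disjoint_left.2 fun x hj hk => hjk (hsep.separated x.1 x.2 j k hj hk),
    fun hK => ?_, ?_, ?_⟩
  · have hout : ∀ a b : ℝ, a ≠ 0 → (¬ ∃ k, (a, b) ∈ Zset s (ν k) (φ k)) →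
        ‖transform w s (superposition α φ ν) a b‖ ≤ (|a| ^ (s / 2))⁻¹ * √ε :=
      fun a b ha hZ => norm_transform_le_of_forall_notMem hsep.mode hM hν1 hs0 hs1 hm hw hε0 hε1 hB
        ha (fun k => (hN' k).2.1) (fun k => (hN' k).2.2) hK (not_exists.1 hZ)
    refine ⟨fun a b ha => ?_, fun a b k hal hau => ?_, fun a b ha => ?_, fun a b k hal hau => ?_⟩
    · refine le_trans ?_ (prob_Rset_outside he h0 h1 hp hw hB hε1 hm ha (hout a b ha))
      have ha0 := abs_pos.2 ha
      have h3 : Real.exp (-(|a| ^ (-s) * ε₁ ^ (-q) / Q)) ≤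
          Real.exp (-(1 / (4 * M ^ 2 * Q) * |a| ^ (-s) * ε₁ ^ (-q))) := by
        apply Real.exp_le_exp.2
        rw [neg_le_neg_iff]
        refine (hcomp _ ha0).trans ?_
        have : 0 < |a| ^ (-s) := Real.rpow_pos_of_pos ha0 _
        gcongr
        refine mul_le_of_le_one_left this.le (inv_le_one_of_one_le₀ (by linarith))
      linarith [hdecay |a| ha0.le (m * (1 - s))]
    · have ha0 : 0 < |a| := lt_of_lt_of_le (div_pos (hν0 k) (by positivity)) hal
      have ha : a ≠ 0 := abs_pos.1 ha0
      refine le_trans ?_ (prob_Rset_outside he h0 h1 hp hw hB hε1 hm ha (hout a b ha))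
      have h3 : Real.exp (-(|a| ^ (-s) * ε₁ ^ (-q) / Q)) ≤
          Real.exp (-(1 / (4 * M ^ 2 * Q) * ν k ^ (-s) * ε₁ ^ (-q))) := by
        apply Real.exp_le_exp.2
        rw [neg_le_neg_iff]
        refine (hcomp _ (hν0 k)).trans ?_
        -- `(2M)^{-s}` is bounded below by `(2M)^{-1}` to keep `c` independent of `s`.
        have h4 : (2 * M)⁻¹ * ν k ^ (-s) ≤ |a| ^ (-s) := by
          calc (2 * M)⁻¹ * ν k ^ (-s) = (2 * M) ^ (-1 : ℝ) * ν k ^ (-s) := by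
                rw [Real.rpow_neg_one]
            _ ≤ (2 * M) ^ (-s) * ν k ^ (-s) := by
                have : 0 < ν k ^ (-s) := Real.rpow_pos_of_pos (hν0 k) _
                gcongr
                · linarith
            _ = (2 * M * ν k) ^ (-s) := (Real.mul_rpow (by positivity) (hν0 k).le).symm
            _ ≤ |a| ^ (-s) := Real.rpow_le_rpow_of_nonpos ha0 hau (by linarith)
        gcongr
      linarith [hdecay (ν k) (hν0 k).le (m * (1 - s))]
    · have ha' : a ≠ 0 := abs_pos.1 (by linarith)
      refine le_trans ?_ (prob_Sset_outside he h0 h1 hp hw hB hε0 hε1 hm (by linarith) hs1 ha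
        (hout a b ha'))
      have h4 : 0 ≤ ε / |a| ^ (m * (1 - s)) := by positivity
      linarith [mul_le_mul_of_nonneg_right hGle h4]
    · have hal1 : 1 ≤ |a| := le_trans ((one_le_div (by positivity)).2 (hN' k).1) hal
      have ha' : a ≠ 0 := abs_pos.1 (by linarith)
      refine le_trans ?_ (prob_Sset_outside he h0 h1 hp hw hB hε0 hε1 hm (by linarith) hs1 hal1
        (hout a b ha'))
      have h7 : G * (ε / |a| ^ (m * (1 - s))) ≤
          (2 * M) ^ m * G * (ε / ν k ^ (m * (1 - s))) := by
        have h8 := decay_rescale (m := m) hM (hν0 k) (by linarith) hs1 hε0.le hal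
        calc _ ≤ G * ((2 * M) ^ m * (ε / ν k ^ (m * (1 - s)))) := by gcongr
          _ = _ := by ring
      have h4 : 0 ≤ ε / ν k ^ (m * (1 - s)) := div_nonneg hε0.le (by have := hν0 k; positivity)
      linarith [mul_le_mul_of_nonneg_right hGle' h4]
  all_goals
    intro a b k hZ
    obtain ⟨hal, hau⟩ := abs_fst_of_mem_Zset (hsep.mode k) hM (by linarith) hs1 (hN' k).1
      (by linarith [hν2 k]) hZ
    have ha0 : 0 < |a| := lt_of_lt_of_le (div_pos (hν0 k) (by positivity)) hal
  · refine (product_le_one_sub_exp (z := 2 - 3 * s) (hν1 k) (by positivity) hεq.le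
      (hdecay (ν k) (hν0 k).le _) (by linarith)).trans ?_
    -- On `R_δ` the lower bound for `|W_g|` carries `ρ = |a|^{-s/2}`; the loss `1/ρ ≤ 2M ν^{s/2}`
    -- cancels the factor `ν^{-s/2}` of `prob_inside`.
    have hρ : 0 < |a| ^ (-s / 2) := Real.rpow_pos_of_pos ha0 _
    refine (prob_inside (p := p) he h0 hε0 hε1 hw hB hm hsep.mode hM (by linarith) hs1 (hN' k).1
      (hν2 k) hZ hρ).trans (measureReal_mono fun ω hω hR => (hω hR.2).trans ?_)
    have hy0 : 0 < ν k ^ (s / 2) := Real.rpow_pos_of_pos (hν0 k) _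
    have hra : |a| ^ (s / 2) ≤ 2 * M * ν k ^ (s / 2) := by
      refine (Real.rpow_le_rpow ha0.le hau (by linarith)).trans ?_
      rw [Real.mul_rpow (by positivity) (hν0 k).le]
      gcongr
      exact Real.rpow_le_self_of_one_le (by linarith) (by linarith)
    rw [neg_div, Real.rpow_neg ha0.le, div_inv_eq_mul]
    calc A * ((√ε + ε₁ ^ p) / ν k ^ (s / 2)) * |a| ^ (s / 2)
        ≤ A * ((√ε + ε₁ ^ p) / ν k ^ (s / 2)) * (2 * M * ν k ^ (s / 2)) := by gcongr
      _ = 2 * M * A * (√ε + ε₁ ^ p) := by field_simp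
      _ ≤ _ := by
        gcongr
        linarith [mul_nonneg (zero_le_one.trans h2M) hG0]
  -- On `S_δ` one takes `ρ = 1` and the factor `ν^{-s/2}` survives. The same tail exponent suffices
  -- because `-2 ≤ 2 - 3s`.
  · refine (product_le_one_sub_exp (z := 2 - 3 * s) (hν1 k) (by positivity) hεq.le
      (hdecay (ν k) (hν0 k).le _) (by linarith)).trans ?_
    refine (prob_inside (p := p) he h0 hε0 hε1 hw hB hm hsep.mode hM (by linarith) hs1 (hN' k).1
      (hν2 k) hZ one_pos).trans (measureReal_mono fun ω hω hR => (hω ?_).trans ?_)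
    · rw [one_mul]
      exact hR.2
    · rw [div_one]
      have hy0 : 0 < ν k ^ (s / 2) := Real.rpow_pos_of_pos (hν0 k) _
      have h5 : 0 ≤ (2 * M) ^ m * G := by positivity
      have h6 : A ≤ 2 * M * A := le_mul_of_one_le_left hA0.le (by linarith)
      exact mul_le_mul_of_nonneg_right (by linarith) (by positivity)

end SST

theorem theorem2p3 (M : ℝ) (hM : 0 < M) (K m : ℕ) (B : ℝ) :
    -- implicit constants: they depend only on `M`, `K`, `m` and the size `B` of the packet
    ∃ c > (0 : ℝ), ∃ C > (0 : ℝ),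
    ∀ s : ℝ, 1 / 2 < s → s < 1 → 2 / (1 - s) + 4 ≤ (m : ℝ) →
    -- `N₀ = C₀ max {ε^{-1/(2s-1)}, ε^{-1/(1-s)}}`
    ∃ C₀ > (0 : ℝ),
    ∀ ε : ℝ, 0 < ε → ε < 1 →
    ∀ w : ℝ → ℂ, SST.IsMotherPacket ε m w → SST.PacketSize B w →
    ∀ N : ℝ, C₀ * max (ε ^ (-1 / (2 * s - 1))) (ε ^ (-1 / (1 - s))) < N →
    ∀ (α φ : Fin K → ℝ → ℝ) (ν : Fin K → ℝ), SST.IsWellSeparated M N K s α φ ν →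
    ∀ ε₁ : ℝ, 0 < ε₁ → ε₁ ≤ 1 →
    ∀ q : ℝ, 0 < q → ∀ p : ℝ, 0 < p → p ≤ 1 / 2 →
    ∀ (Ω : Type*) [MeasurableSpace Ω] (P : MeasureTheory.Measure Ω)
      [MeasureTheory.IsProbabilityMeasure P]
      (e : MeasureTheory.Lp ℝ 2 (MeasureTheory.volume : MeasureTheory.Measure ℝ) → Ω → ℝ),
    SST.IsWhiteNoise P (ε₁ ^ (1 + q)) e →
    ∀ f : ℝ → ℂ, f = SST.superposition α φ ν →
    ∀ δ : ℝ, δ = √ε + ε₁ ^ (1 / 2 - p) →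
    -- (i)
    (Pairwise fun j k : Fin K => Disjoint (SST.Zset s (ν j) (φ j)) (SST.Zset s (ν k) (φ k))) ∧
    (2 * M * K * √ε ≤ 2 ^ m →
      -- (ii), in terms of `|a|`, and in terms of every `N_k` that is comparable to `|a|`
      (∀ a b : ℝ, a ≠ 0 →
        1 - Real.exp (-(c * |a| ^ (-s) * ε₁ ^ (-q))) - C * (ε / |a| ^ (m * (1 - s))) ≤
          P.real {ω | (a, b) ∈ SST.Rset w s f e δ ω → ∃ k, (a, b) ∈ SST.Zset s (ν k) (φ k)}) ∧
      (∀ (a b : ℝ) (k : Fin K), ν k / (2 * M) ≤ |a| → |a| ≤ 2 * M * ν k →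
        1 - Real.exp (-(c * ν k ^ (-s) * ε₁ ^ (-q))) - C * (ε / ν k ^ (m * (1 - s))) ≤
          P.real {ω | (a, b) ∈ SST.Rset w s f e δ ω → ∃ j, (a, b) ∈ SST.Zset s (ν j) (φ j)}) ∧
      -- (iii), in the same two forms
      (∀ a b : ℝ, 1 ≤ |a| →
        1 - Real.exp (-(ε₁ ^ (-q) * (SST.normSqL2 w)⁻¹)) - C * (ε / |a| ^ (m * (1 - s))) ≤
          P.real {ω | (a, b) ∈ SST.Sset w s f e δ ω → ∃ k, (a, b) ∈ SST.Zset s (ν k) (φ k)}) ∧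
      (∀ (a b : ℝ) (k : Fin K), ν k / (2 * M) ≤ |a| → |a| ≤ 2 * M * ν k →
        1 - Real.exp (-(ε₁ ^ (-q) * (SST.normSqL2 w)⁻¹)) - C * (ε / ν k ^ (m * (1 - s))) ≤
          P.real {ω | (a, b) ∈ SST.Sset w s f e δ ω → ∃ j, (a, b) ∈ SST.Zset s (ν j) (φ j)})) ∧
    -- (iv)
    (∀ (a b : ℝ) (k : Fin K), (a, b) ∈ SST.Zset s (ν k) (φ k) →
      (1 - Real.exp (-(c * ν k ^ (2 - 3 * s) * ε₁ ^ (-q)))) *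
            (1 - Real.exp (-(c * ν k ^ (-s - 2) * ε₁ ^ (-q))))
          - C * (ε / ν k ^ ((m - 4) * (1 - s) - 2)) ≤
        P.real {ω | (a, b) ∈ SST.Rset w s f e δ ω →
          SST.relErr (SST.noisyInfo w s f e ω a b) (ν k) (φ k) b ≤ C * (√ε + ε₁ ^ p)}) ∧
    -- (v)
    (∀ (a b : ℝ) (k : Fin K), (a, b) ∈ SST.Zset s (ν k) (φ k) →
      (1 - Real.exp (-(c * ν k ^ (2 - 2 * s) * ε₁ ^ (-q)))) *
            (1 - Real.exp (-(c * ν k ^ (-2 : ℝ) * ε₁ ^ (-q))))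
          - C * (ε / ν k ^ ((m - 4) * (1 - s) - 2)) ≤
        P.real {ω | (a, b) ∈ SST.Sset w s f e δ ω →
          SST.relErr (SST.noisyInfo w s f e ω a b) (ν k) (φ k) b ≤
            C * ((√ε + ε₁ ^ p) / ν k ^ (s / 2))}) := by
  -- Any mode forces `M ≥ 1`, so `max M 1 = M` unless `K = 0`, where there is no component;
  -- enlarging `B` only weakens the size condition.
  obtain ⟨c, hc, C, hC, h⟩ := SST.concentration_of_one_le (max M 1) (le_max_right _ _) K m
    (max B 1) (le_max_right _ _)
  refine ⟨c, hc, C, hC, fun s hs0 hs1 hms => ?_⟩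
  obtain ⟨C₀, hC₀, h⟩ := h s hs0 hs1 hms
  refine ⟨C₀, hC₀, ?_⟩
  intro ε hε0 hε1 w hw hB N hN α φ ν hsep ε₁ h0 h1 q hq p hp hp2 Ω _ P _ e he f hf δ hδ
  have hM1 : ∀ _ : Fin K, max M 1 = M := fun k => max_eq_left ((hsep.mode k).one_le hM)
  have hsep' : SST.IsWellSeparated (max M 1) N K s α φ ν :=
    ⟨fun k => by rw [hM1 k]; exact hsep.mode k, hsep.freq_ge, hsep.separated⟩
  obtain ⟨h1', h2', h3', h4'⟩ := h ε hε0 hε1 w hw (hB.mono (hB.pos hw) (le_max_left _ _)) N hN α φ ν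
    hsep' ε₁ h0 h1 q hq p hp hp2 Ω P e he f hf δ hδ
  refine ⟨h1', fun hK => ?_, h3', h4'⟩
  have hK' : 2 * max M 1 * K * √ε ≤ 2 ^ m := by
    rcases K.eq_zero_or_pos with h | h
    · subst h
      simp
    · rwa [hM1 ⟨0, h⟩]
  obtain ⟨k1, k2, k3, k4⟩ := h2' hK'
  refine ⟨k1, fun a b k => ?_, k3, fun a b k => ?_⟩
  · have := k2 a b k
    rwa [hM1 k] at this
  · have := k4 a b k
    rwa [hM1 k] at this
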